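/- **Setting.** Let $X\in\mathbb R^{n\times p}$ ($n,p\ge 1$) be a fixed design, $\beta^*\in\mathbb R^p$, $\sigma\ge 0$, and $y=X\beta^*+w$ with $w\sim\mathcal N(0,\sigma^2I_n)$. Let $S=\{i:\beta^*_i\neq 0\}$, $s=|S|$, $$S_1=\Big\{i\in S:\ |\beta^*_i|\ge 2\sigma\log p\sqrt{\tfrac{\log p}{n}}\Big\},\qquad S_2=\Big\{i\in S:\ |\beta^*_i|\le 2\sigma\sqrt{\tfrac{\log p}{n}}\Big\},$$ $s_1=|S_1|$, $s_2=|S_2|$, and assume $S_1\neq\emptyset$. Let $m$ be the $s_1$-th largest of the values $|\beta^*_i|$ and $\kappa=\max_i|\beta^*_i|/m$. The matrix $X$ has the $(k,\delta)$-restricted isometry property (RIP) if $(1-\delta)\|u\|^2\le n^{-1}\|Xu\|^2\le(1+\delta)\|u\|^2$ for every $u\in\mathbb R^p$ with at most $k$ nonzero components. Gradient descent with step size $\eta$ and initialization level $\alpha$ is: $g_0=\alpha\mathbf 1$, $l_0=\mathbf 0$, $$g_{t+1}=g_t-\eta\, l_t\circ\big[n^{-1}X^T(X(g_t\circ l_t)-y)\big],\qquad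 l_{t+1}=l_t-\eta\, g_t\circ\big[n^{-1}X^T(X(g_t\circ l_t)-y)\big],$$ where $\circ$ is the componentwise product. Put $\beta_t=g_t\circ l_t$ and $\tau=\max\{\delta\alpha,\ \sigma\sqrt{\log p/n}\}$. **Theorem (variable selection consistency).** For every $C>0$ there are positive constants $c_\delta,c_\alpha,c_\eta,\tilde c_1,\tilde c_2,\tilde c_3,\tilde c_4,\tilde c_{10},\tilde c_{11}$, depending only on $C$, such that the following holds for all $n,p,X,\beta^*,\sigma,\delta,\alpha,\eta$ as above satisfying * (A) $S=S_1\cup S_2$, $s=s_1+s_2$, and $\kappa m\le C$; * (B) $X$ satisfies the $(s+1,\delta)$-RIP with $\delta\le c_\delta/\big(\kappa\sqrt s\,\log\frac p\alpha\big)$; * (C) $0<\alpha\le c_\alpha/p$ and $0<\eta\le c_\eta/\big(\kappa\log\frac p\alpha\big)$. For every $t\in\mathbb N$ with $\tilde c_1\log(\frac p\alpha)/(\eta m)\le t\le \tilde c_2/(\eta\tau)$ (no upper limit if $\tau=0$), with probability at least $1-p^{-\tilde c_3}-n^{-\tilde c_4}$ the following holds: for every $\lambda\in\big[\tilde c_{10}/p,\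 \tilde c_{11}\sigma\sqrt{\log p/n}\,\big]$, the hard-thresholded estimator $$\beta'_{t,j}=\begin{cases}\beta_{t,j},&|\beta_{t,j}|\ge\lambda,\\ 0,&|\beta_{t,j}|<\lambda,\end{cases}\qquad j=1,\dots,p,$$ satisfies $\{j:\ \beta'_{t,j}\ne 0\}=S_1$. -/

import Mathlib

open MeasureTheory ProbabilityTheory
open scoped Matrix

/-- The support `{j : u_j ≠ 0}` of a vector. -/
noncomputable def vecSupport {p : ℕ} (u : Fin p → ℝ) : Finset (Fin p) :=
  Finset.univ.filter fun j => u j ≠ 0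

/-- The strong signals: nonzero components with `|β_i| ≥ 2 σ (log p) √(log p / n)`. -/
noncomputable def strongSignals (n : ℕ) {p : ℕ} (σ : ℝ) (β : Fin p → ℝ) : Finset (Fin p) :=
  (vecSupport β).filter fun i =>
    2 * σ * Real.log p * Real.sqrt (Real.log p / n) ≤ |β i|

/-- The weak signals: nonzero components with `|β_i| ≤ 2 σ √(log p / n)`. -/
noncomputable def weakSignals (n : ℕ) {p : ℕ} (σ : ℝ) (β : Fin p → ℝ) : Finset (Fin p) :=
  (vecSupport β).filter fun i => |β i| ≤ 2 * σ * Real.sqrt (Real.log p / n)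

/-- The `k`-th largest absolute component `θ_k(β)` (for `1 ≤ k ≤ p`): the greatest level which at
least `k` components reach in absolute value. -/
noncomputable def kthLargestAbs {p : ℕ} (k : ℕ) (β : Fin p → ℝ) : ℝ :=
  sSup {x : ℝ | k ≤ (Finset.univ.filter fun i => x ≤ |β i|).card}

/-- For `1 ≤ k ≤ p` the supremum in the definition of `θ_k(β)` is attained. -/
theorem kthLargestAbs_isGreatest {p : ℕ} {k : ℕ} (hk : 1 ≤ k) (hkp : k ≤ p) (β : Fin p → ℝ) :
    IsGreatest {x : ℝ | k ≤ (Finset.univ.filter fun i => x ≤ |β i|).card}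
      (kthLargestAbs k β) := by
  set A : Set ℝ := {x : ℝ | k ≤ (Finset.univ.filter fun i => x ≤ |β i|).card} with hA
  -- the levels in `A` that are values of `|β|`
  have up : ∀ x ∈ A, ∃ i, x ≤ |β i| ∧ |β i| ∈ A := by
    intro x hx
    have hne : (Finset.univ.filter fun i => x ≤ |β i|).Nonempty := by
      rw [← Finset.card_pos]
      exact lt_of_lt_of_le hk hx
    obtain ⟨i, hi, hmin⟩ := Finset.exists_min_image _ (fun i => |β i|) hne
    refine ⟨i, (Finset.mem_filter.1 hi).2, ?_⟩
    refine le_trans hx (Finset.card_le_card ?_)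
    intro j hj
    exact Finset.mem_filter.2 ⟨Finset.mem_univ _, hmin j hj⟩
  have h0 : (0 : ℝ) ∈ A := by
    simpa [hA] using hkp
  obtain ⟨i0, -, hi0⟩ := up 0 h0
  have hne : (Finset.univ.filter fun i => |β i| ∈ A).Nonempty := by
    classical
    exact ⟨i0, Finset.mem_filter.2 ⟨Finset.mem_univ _, hi0⟩⟩
  obtain ⟨j, hj, hmax⟩ := Finset.exists_max_image _ (fun i => |β i|) hne
  have hg : IsGreatest A |β j| := by
    refine ⟨(Finset.mem_filter.1 hj).2, ?_⟩
    intro x hx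
    obtain ⟨i, hxi, hi⟩ := up x hx
    exact hxi.trans (hmax i (Finset.mem_filter.2 ⟨Finset.mem_univ _, hi⟩))
  have : kthLargestAbs k β = |β j| := hg.csSup_eq
  rw [this]
  exact hg

/-- The minimal strength `m = θ_{s₁}(β)` of the strong signals, where `s₁ = |S₁|`. -/
noncomputable def minStrength (n : ℕ) {p : ℕ} (σ : ℝ) (β : Fin p → ℝ) : ℝ :=
  kthLargestAbs (strongSignals n σ β).card β

/-- The strong-signal condition number `κ`: largest absolute signal over smallest strong signal. -/
noncomputable def condNumber (n : ℕ) {p : ℕ} (σ : ℝ) (β : Fin p → ℝ) : ℝ :=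
  (⨆ i, |β i|) / minStrength n σ β

/-- The `(k, δ)`-restricted isometry property:
`(1 - δ)‖u‖² ≤ n⁻¹ ‖X u‖² ≤ (1 + δ)‖u‖²` for all `k`-sparse `u`, with Euclidean norms. -/
def RIP {n p : ℕ} (X : Matrix (Fin n) (Fin p) ℝ) (k : ℕ) (δ : ℝ) : Prop :=
  ∀ u : Fin p → ℝ, (vecSupport u).card ≤ k →
    (1 - δ) * ∑ j, u j ^ 2 ≤ (1 / (n : ℝ)) * ∑ i, (X *ᵥ u) i ^ 2 ∧
      (1 / (n : ℝ)) * ∑ i, (X *ᵥ u) i ^ 2 ≤ (1 + δ) * ∑ j, u j ^ 2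

/-- The vector `n⁻¹ Xᵀ (X (g ∘ l) - y)`. -/
noncomputable def residualGrad {n p : ℕ} (X : Matrix (Fin n) (Fin p) ℝ) (y : Fin n → ℝ)
    (g l : Fin p → ℝ) : Fin p → ℝ :=
  (1 / (n : ℝ)) • (Xᵀ *ᵥ (X *ᵥ (g * l) - y))

/-- Gradient descent iterates `(g_t, l_t)` for `f(g, l) = (2n)⁻¹ ‖X (g ∘ l) - y‖²` with step size
`η`, started from `g₀ = α 𝟏`, `l₀ = 0`. Products of vectors are componentwise. -/
noncomputable def gdIterate {n p : ℕ} (X : Matrix (Fin n) (Fin p) ℝ) (y : Fin n → ℝ) (α η : ℝ) :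
    ℕ → (Fin p → ℝ) × (Fin p → ℝ)
  | 0 => (fun _ => α, fun _ => 0)
  | t + 1 =>
      let g := (gdIterate X y α η t).1
      let l := (gdIterate X y α η t).2
      (g - η • (l * residualGrad X y g l), l - η • (g * residualGrad X y g l))

/-- The estimator `β_t = g_t ∘ l_t`. -/
noncomputable def gdEstimator {n p : ℕ} (X : Matrix (Fin n) (Fin p) ℝ) (y : Fin n → ℝ) (α η : ℝ)
    (t : ℕ) : Fin p → ℝ :=
  (gdIterate X y α η t).1 * (gdIterate X y α η t).2

/-- Componentwise hard thresholding at level `lam`. -/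
noncomputable def hardThreshold {p : ℕ} (lam : ℝ) (β : Fin p → ℝ) : Fin p → ℝ :=
  fun j => if lam ≤ |β j| then β j else 0

/-- The Gaussian law `N(0, σ² I)` on `ℝⁿ`. -/
noncomputable def gaussianNoise (n : ℕ) (σ : ℝ) : Measure (Fin n → ℝ) :=
  Measure.pi fun _ => gaussianReal 0 ⟨σ ^ 2, sq_nonneg σ⟩

/-- The quantity `τ = max {δ α, σ √(log p / n)}` limiting the number of iterations. -/
noncomputable def tauLevel (n p : ℕ) (σ δ α : ℝ) : ℝ :=
  max (δ * α) (σ * Real.sqrt (Real.log p / n))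

/-! Put `a = g + l` and `b = g - l`. Then `g ∘ l = (a² - b²) / 4`, and gradient descent multiplies
`a` by `1 - η r` and `b` by `1 + η r` in each coordinate, where `r` is the gradient of the loss. Let
`θ` be the restriction of the truth to the strong signals. By the RIP (`RIP.residual_sub_le`) `r = β
- θ + e` with `|e| ≤ ε D + T`, where `ε = δ√s`, `D` bounds the error on the strong coordinates and
`T` is of order `τ`. So the coordinates interact only through `e`.

On a strong coordinate with `θ > 0` (otherwise swap `a` and `b`), `a` grows geometrically until half
of the target is reached, after which the error contracts (`StrongState.update`). On any other
coordinate both factors stay below `α exp(η Σ |e|)` (`null_coordinate_step`). The two statements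
need each other and are proved by one induction (`signal_recovery_of_dynamics`). It closes because
the accumulated perturbation is at most `1`: the growth phase costs about `ε κ log(p/α)`, the
contraction phase `ε κ`, and the floor `t η τ`. Assumption (B) and the stopping time bound these.

Hence at time `t` the strong entries have size at least `m / 2`, far above `τ`, and the others are
at most `2 α² < 1 / p`. Every admissible threshold separates them. Randomness enters only through
the bound on `n⁻¹ Xᵀ w`. -/

/-! ### Dynamics of a single coordinate. -/

/-- One step of the dynamics on a coordinate with target `θ > 0`: positivity and the bound on the
product persist, and the error contracts at rate `η (a² + b²) / 2` up to the perturbation `e`. -/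
theorem strong_coordinate_step {a b α θ η e : ℝ} (ha : 0 < a) (hb : 0 < b)
    (hab : a * b ≤ α ^ 2) (hθ : 0 < θ) (hαθ : α ^ 2 ≤ θ) (hη : 0 < η) (hηθ : η * θ ≤ 1 / 1000)
    (he : |e| ≤ θ / 16) (hΔ : |(a ^ 2 - b ^ 2) / 4 - θ| ≤ θ) :
    0 < a * (1 - η * ((a ^ 2 - b ^ 2) / 4 - θ + e)) ∧
    0 < b * (1 + η * ((a ^ 2 - b ^ 2) / 4 - θ + e)) ∧
    (a * (1 - η * ((a ^ 2 - b ^ 2) / 4 - θ + e))) *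
      (b * (1 + η * ((a ^ 2 - b ^ 2) / 4 - θ + e))) ≤ α ^ 2 ∧
    b ^ 2 ≤ α ^ 2 ∧
    η * ((a ^ 2 + b ^ 2) / 2) ≤ 1 / 200 ∧
    |((a * (1 - η * ((a ^ 2 - b ^ 2) / 4 - θ + e))) ^ 2 -
      (b * (1 + η * ((a ^ 2 - b ^ 2) / 4 - θ + e))) ^ 2) / 4 - θ| ≤
      (1 - 9 / 10 * (η * ((a ^ 2 + b ^ 2) / 2))) * |(a ^ 2 - b ^ 2) / 4 - θ| +
        11 / 10 * (η * ((a ^ 2 + b ^ 2) / 2)) * |e| := by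
  set β := (a ^ 2 - b ^ 2) / 4 with hβ
  set q := (a ^ 2 + b ^ 2) / 2 with hq
  set ρ := β - θ + e with hρ
  have hβ0 : 0 ≤ β := by linarith [(abs_le.1 hΔ).1]
  have hβ2 : β ≤ 2 * θ := by linarith [(abs_le.1 hΔ).2]
  have hba : b ≤ a := by
    have : b ^ 2 ≤ a ^ 2 := by linarith
    exact (pow_le_pow_iff_left₀ hb.le ha.le two_ne_zero).1 this
  have hb2 : b ^ 2 ≤ α ^ 2 := by nlinarith
  have hq5 : q ≤ 5 * θ := by
    have : q = 2 * β + b ^ 2 := by rw [hq, hβ]; ring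
    linarith
  have hq0 : 0 < q := by positivity
  have hηq : η * q ≤ 1 / 200 := by nlinarith
  have hηq0 : 0 < η * q := by positivity
  have hρle : |ρ| ≤ |β - θ| + |e| := abs_add_le _ _
  have hρ2 : |ρ| ≤ 2 * θ := by linarith
  have hηρ : η * |ρ| ≤ 1 / 500 := by nlinarith
  have hηρ' : |η * ρ| ≤ 1 / 500 := by rw [abs_mul, abs_of_pos hη]; exact hηρ
  obtain ⟨h1, h2⟩ := abs_le.1 hηρ'
  refine ⟨mul_pos ha (by linarith), mul_pos hb (by linarith), ?_, hb2, hηq, ?_⟩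
  -- The factors multiply to `1 - (ηρ)²`, so the product `a b` never grows; with `b ≤ a` this keeps
  -- `b` below `α`.
  · have : a * (1 - η * ρ) * (b * (1 + η * ρ)) = a * b * (1 - (η * ρ) ^ 2) := by ring
    rw [this]
    have hab0 := mul_pos ha hb
    nlinarith [sq_nonneg (η * ρ)]
  -- The first-order part is an exact contraction by `1 - η q`. The second-order term `β (ηρ)²` is
  -- absorbed by the slack between `1` and the constants `9/10`, `11/10`, because `β ≤ q / 2`.
  · have key : ((a * (1 - η * ρ)) ^ 2 - (b * (1 + η * ρ)) ^ 2) / 4 - θ =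
        (1 - η * q) * (β - θ) + (-(η * q * e) + β * (η * ρ) ^ 2) := by
      simp only [hq, hρ, hβ]; ring
    rw [key]
    have hquad : |β * (η * ρ) ^ 2| ≤ η * q / 1000 * (|β - θ| + |e|) := by
      rw [abs_of_nonneg (by positivity), ← sq_abs (η * ρ)]
      have hβq : β ≤ q / 2 := by rw [hq, hβ]; nlinarith [sq_nonneg b]
      have e1 : |η * ρ| = η * |ρ| := by rw [abs_mul, abs_of_pos hη]
      calc β * |η * ρ| ^ 2 ≤ q / 2 * (1 / 500 * (η * (|β - θ| + |e|))) := by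
            refine mul_le_mul hβq ?_ (by positivity) (by positivity)
            rw [sq]
            refine mul_le_mul hηρ' ?_ (abs_nonneg _) (by norm_num)
            rw [e1]
            exact mul_le_mul_of_nonneg_left hρle hη.le
        _ = _ := by ring
    calc |(1 - η * q) * (β - θ) + (-(η * q * e) + β * (η * ρ) ^ 2)|
        ≤ |(1 - η * q) * (β - θ)| + (|-(η * q * e)| + |β * (η * ρ) ^ 2|) :=
          (abs_add_le _ _).trans (by gcongr; exact abs_add_le _ _)
      _ ≤ (1 - η * q) * |β - θ| + (η * q * |e| + η * q / 1000 * (|β - θ| + |e|)) := by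
          rw [abs_mul, abs_of_nonneg (by linarith : 0 ≤ 1 - η * q), abs_neg, abs_mul (η * q),
            abs_of_pos hηq0]
          gcongr
      _ ≤ _ := by
          have := mul_nonneg hηq0.le (abs_nonneg (β - θ))
          have := mul_nonneg hηq0.le (abs_nonneg e)
          nlinarith

/-- The state of a coordinate with target `θ > 0`: it has reached half of the target or is still
growing, and its error is below the envelope `F`. -/
structure StrongState (α θ growth F a b : ℝ) : Prop where
  a_pos : 0 < a
  b_pos : 0 < b
  mul_le : a * b ≤ α ^ 2
  err_le : |(a ^ 2 - b ^ 2) / 4 - θ| ≤ θ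
  err_le_env : |(a ^ 2 - b ^ 2) / 4 - θ| ≤ F
  phase : |(a ^ 2 - b ^ 2) / 4 - θ| ≤ θ / 2 ∨ ((a ^ 2 - b ^ 2) / 4 - θ < -(θ / 2) ∧ growth ≤ a)

/-- Below half of the target, `a² < 2θ + b² ≤ 2θ + α²`, so once the guaranteed growth exceeds this
level the growing phase must be over. -/
theorem StrongState.half {α θ growth F a b : ℝ} (h : StrongState α θ growth F a b)
    (hg : 2 * θ + α ^ 2 < growth ^ 2) (hg0 : 0 ≤ growth) :
    |(a ^ 2 - b ^ 2) / 4 - θ| ≤ θ / 2 := by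
  rcases h.phase with h1 | ⟨h1, h2⟩
  · exact h1
  · exfalso
    have hβ0 : 0 ≤ (a ^ 2 - b ^ 2) / 4 := by linarith [(abs_le.1 h.err_le).1]
    have hba : b ≤ a := by
      have : b ^ 2 ≤ a ^ 2 := by linarith
      exact (pow_le_pow_iff_left₀ h.b_pos.le h.a_pos.le two_ne_zero).1 this
    have hb2 : b ^ 2 ≤ α ^ 2 := by nlinarith [h.mul_le, h.b_pos]
    have : growth ^ 2 ≤ a ^ 2 := pow_le_pow_left₀ hg0 h2 2
    linarith

/-- The state persists, with growth factor `1 + η m / 4`, for any new envelope `F'` that follows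
from the contraction of the error. -/
theorem StrongState.step {a b α θ η e m growth F : ℝ} (h : StrongState α θ growth F a b)
    (hm : 0 < m) (hmθ : m ≤ θ) (hαθ : α ^ 2 ≤ θ) (hη : 0 < η)
    (hηθ : η * θ ≤ 1 / 1000) (he : |e| ≤ m / 16) {F' : ℝ}
    (hF' : |((a * (1 - η * ((a ^ 2 - b ^ 2) / 4 - θ + e))) ^ 2 -
      (b * (1 + η * ((a ^ 2 - b ^ 2) / 4 - θ + e))) ^ 2) / 4 - θ| ≤ θ →
      |((a * (1 - η * ((a ^ 2 - b ^ 2) / 4 - θ + e))) ^ 2 -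
      (b * (1 + η * ((a ^ 2 - b ^ 2) / 4 - θ + e))) ^ 2) / 4 - θ| ≤
      (1 - 9 / 10 * (η * ((a ^ 2 + b ^ 2) / 2))) * |(a ^ 2 - b ^ 2) / 4 - θ| +
        11 / 10 * (η * ((a ^ 2 + b ^ 2) / 2)) * |e| →
      |((a * (1 - η * ((a ^ 2 - b ^ 2) / 4 - θ + e))) ^ 2 -
      (b * (1 + η * ((a ^ 2 - b ^ 2) / 4 - θ + e))) ^ 2) / 4 - θ| ≤ F') :
    StrongState α θ (growth * (1 + η * m / 4)) F'
      (a * (1 - η * ((a ^ 2 - b ^ 2) / 4 - θ + e)))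
      (b * (1 + η * ((a ^ 2 - b ^ 2) / 4 - θ + e))) := by
  have hθ : 0 < θ := hm.trans_le hmθ
  have heθ : |e| ≤ θ / 16 := by linarith
  obtain ⟨ha', hb', hab', hb2, hηq, hcon⟩ :=
    strong_coordinate_step h.a_pos h.b_pos h.mul_le hθ hαθ hη hηθ heθ h.err_le
  have hηq0 : 0 ≤ η * ((a ^ 2 + b ^ 2) / 2) := by positivity
  -- Any level `D ≥ θ / 2` is preserved, since `|e| ≤ θ / 16 ≤ D / 8`. It is used with `D = θ` and
  -- `D = θ / 2`.
  have hmono : ∀ D : ℝ, θ / 2 ≤ D → |(a ^ 2 - b ^ 2) / 4 - θ| ≤ D →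
      |((a * (1 - η * ((a ^ 2 - b ^ 2) / 4 - θ + e))) ^ 2 -
      (b * (1 + η * ((a ^ 2 - b ^ 2) / 4 - θ + e))) ^ 2) / 4 - θ| ≤ D := by
    intro D hD hΔD
    refine hcon.trans ?_
    have h1 : (1 - 9 / 10 * (η * ((a ^ 2 + b ^ 2) / 2))) * |(a ^ 2 - b ^ 2) / 4 - θ| ≤
        (1 - 9 / 10 * (η * ((a ^ 2 + b ^ 2) / 2))) * D :=
      mul_le_mul_of_nonneg_left hΔD (by linarith)
    have h2 : 11 / 10 * (η * ((a ^ 2 + b ^ 2) / 2)) * |e| ≤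
        11 / 10 * (η * ((a ^ 2 + b ^ 2) / 2)) * (D / 8) :=
      mul_le_mul_of_nonneg_left (by linarith) (by positivity)
    have h3 : 0 ≤ η * ((a ^ 2 + b ^ 2) / 2) * D := mul_nonneg hηq0 (by linarith)
    nlinarith
  have herr := hmono θ (by linarith) h.err_le
  refine ⟨ha', hb', hab', herr, hF' herr hcon, ?_⟩
  rcases h.phase with h1 | ⟨h1, h2⟩
  · exact Or.inl (hmono _ le_rfl h1)
  · set β := (a ^ 2 - b ^ 2) / 4 with hβ
    set q := (a ^ 2 + b ^ 2) / 2 with hq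
    rcases le_or_gt |((a * (1 - η * (β - θ + e))) ^ 2 -
      (b * (1 + η * (β - θ + e))) ^ 2) / 4 - θ| (θ / 2) with h3 | h3
    · exact Or.inl h3
    right
    constructor
    · rcases lt_abs.1 h3 with h4 | h4
      -- A coordinate below `θ / 2` cannot jump above `3θ / 2` in one step: the new error is at most
      -- `2β - θ + θ / 100`.
      · exfalso
        have hβ0 : 0 ≤ β := by linarith [(abs_le.1 h.err_le).1]
        have key : ((a * (1 - η * (β - θ + e))) ^ 2 - (b * (1 + η * (β - θ + e))) ^ 2) / 4 - θ =
            (β - θ) - (η * q) * (β - θ + e) + β * (η * (β - θ + e)) ^ 2 := by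
          simp only [hq, hβ]; ring
        rw [key] at h4
        obtain ⟨e1, e2⟩ := abs_le.1 heθ
        have hρ1 : -(2 * θ) ≤ β - θ + e := by linarith
        have hρ2 : β - θ + e ≤ 0 := by linarith
        have i1 : η * q * -(β - θ + e) ≤ 1 / 200 * (2 * θ) :=
          mul_le_mul hηq (by linarith) (by linarith) (by norm_num)
        have i2 : (η * (β - θ + e)) ^ 2 ≤ 1 := by
          rw [sq_le_one_iff_abs_le_one, abs_mul, abs_of_pos hη, abs_of_nonpos hρ2]
          have : η * -(β - θ + e) ≤ η * (2 * θ) :=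
            mul_le_mul_of_nonneg_left (by linarith) hη.le
          linarith
        have i3 : β * (η * (β - θ + e)) ^ 2 ≤ β * 1 := mul_le_mul_of_nonneg_left i2 hβ0
        linarith
      · linarith
    · have e1 := (abs_le.1 heθ).2
      have hρ : m / 4 ≤ -(β - θ + e) := by linarith
      have : growth * (1 + η * m / 4) ≤ a * (1 + η * m / 4) :=
        mul_le_mul_of_nonneg_right h2 (by positivity)
      refine this.trans (mul_le_mul_of_nonneg_left ?_ h.a_pos.le)
      have : η * (m / 4) ≤ η * -(β - θ + e) := mul_le_mul_of_nonneg_left hρ hη.le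
      linarith

/-- The contraction of the error past the half-way point, against a geometric envelope. -/
theorem envelope_step {q m η D Y ε x e T : ℝ} (hq : m ≤ q) (hm : 0 < m) (hη : 0 < η)
    (hηq : η * q ≤ 1 / 200) (hε : ε ≤ 1 / 1000) (hY : 0 ≤ Y) (hT : 0 ≤ T)
    (hD : D ≤ Y + 4 * T) (he : e ≤ ε * (Y + 4 * T) + T)
    (hx : x ≤ (1 - 9 / 10 * (η * q)) * D + 11 / 10 * (η * q) * e) :
    x ≤ Y * (1 - η * m / 2) + 4 * T := by
  have hηq0 : 0 < η * q := mul_pos hη (hm.trans_le hq)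
  have h1 : (1 - 9 / 10 * (η * q)) * D ≤ (1 - 9 / 10 * (η * q)) * (Y + 4 * T) :=
    mul_le_mul_of_nonneg_left hD (by linarith)
  have he' : e ≤ 1 / 1000 * (Y + 4 * T) + T :=
    he.trans (by gcongr)
  have h2 : 11 / 10 * (η * q) * e ≤ 11 / 10 * (η * q) * (1 / 1000 * (Y + 4 * T) + T) :=
    mul_le_mul_of_nonneg_left he' (by positivity)
  have h3 : η * m * Y ≤ η * q * Y := by gcongr
  have h4 := mul_nonneg hηq0.le hY
  have h5 := mul_nonneg hηq0.le hT
  -- The floor `4T` is stable: per unit of `η q` the contraction removes `9/10 · 4T`, while the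
  -- perturbation adds little more than `11/10 · T`.
  nlinarith

/-- One step of the dynamics on a coordinate with target `0`: the larger of the two factors grows
at most at the rate of the perturbation. -/
theorem null_coordinate_step {a b A η e E : ℝ} (ha : 0 < a) (hb : 0 < b) (haA : a ≤ A)
    (hbA : b ≤ A) (hA : A ≤ 1) (hη : 0 < η) (hη1 : η ≤ 1 / 2) (he : |e| ≤ E) (hE : η * E < 1 / 2) :
    0 < a * (1 - η * ((a ^ 2 - b ^ 2) / 4 + e)) ∧
    0 < b * (1 + η * ((a ^ 2 - b ^ 2) / 4 + e)) ∧
    a * (1 - η * ((a ^ 2 - b ^ 2) / 4 + e)) ≤ A * (1 + η * E) ∧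
    b * (1 + η * ((a ^ 2 - b ^ 2) / 4 + e)) ≤ A * (1 + η * E) := by
  have aux : ∀ a b e : ℝ, 0 < a → 0 < b → a ≤ A → b ≤ A → |e| ≤ E →
      0 < a * (1 - η * ((a ^ 2 - b ^ 2) / 4 + e)) ∧
      a * (1 - η * ((a ^ 2 - b ^ 2) / 4 + e)) ≤ A * (1 + η * E) := by
    intro a b e ha hb haA hbA he
    obtain ⟨e1, e2⟩ := abs_le.1 he
    have hA0 : 0 < A := ha.trans_le haA
    have hE0 : 0 ≤ E := (abs_nonneg _).trans he
    have ha1 : a ≤ 1 := haA.trans hA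
    have hb1 : b ≤ 1 := hbA.trans hA
    have hηe1 : η * e ≤ η * E := by gcongr
    have hηe2 : -(η * E) ≤ η * e := by nlinarith
    constructor
    · refine mul_pos ha ?_
      have : (a ^ 2 - b ^ 2) / 4 ≤ 1 := by nlinarith
      nlinarith
    -- Without `e` the factors attract each other: `a` shrinks if `b ≤ a`, and otherwise moves a
    -- fraction at most `1` of the way to `b`.
    · have h1 : a * (1 - η * ((a ^ 2 - b ^ 2) / 4)) ≤ A := by
        rcases le_total b a with h | h
        · have : 0 ≤ (a ^ 2 - b ^ 2) / 4 := by nlinarith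
          nlinarith [mul_nonneg hη.le this]
        · have : η * a * (a + b) / 4 ≤ 1 := by
            have : η * a ≤ 1 / 2 * 1 := by gcongr
            nlinarith [mul_pos hη ha]
          have h2 : a * (1 - η * ((a ^ 2 - b ^ 2) / 4)) = a + (η * a * (a + b) / 4) * (b - a) := by
            ring
          nlinarith
      have h2 : a * (η * -e) ≤ A * (η * E) := by
        have : η * -e ≤ η * E := by linarith
        calc a * (η * -e) ≤ a * (η * E) := by gcongr
          _ ≤ A * (η * E) := by gcongr
      nlinarith
  obtain ⟨h1, h2⟩ := aux a b e ha hb haA hbA he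
  obtain ⟨h3, h4⟩ := aux b a (-e) hb ha hbA haA (by rwa [abs_neg])
  have e1 : b * (1 - η * ((b ^ 2 - a ^ 2) / 4 + -e)) =
      b * (1 + η * ((a ^ 2 - b ^ 2) / 4 + e)) := by ring
  rw [e1] at h3 h4
  exact ⟨h1, h3, h2, h4⟩

/-! ### Restricted isometry and the gradient of the loss. -/

/-- Turns the RIP, a statement on norms, into one on inner products; with `v` a basis vector the
right side is an entry of `Xᵀ X u`. -/
theorem mulVec_sq_polarization {n p : ℕ} (X : Matrix (Fin n) (Fin p) ℝ) (u v : Fin p → ℝ) (c : ℝ) :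
    ∑ i, (X *ᵥ (v + c • u)) i ^ 2 - ∑ i, (X *ᵥ (v + (-c) • u)) i ^ 2 =
      4 * c * ∑ i, (X *ᵥ v) i * (X *ᵥ u) i := by
  rw [← Finset.sum_sub_distrib, Finset.mul_sum]
  refine Finset.sum_congr rfl fun i _ => ?_
  simp only [Matrix.mulVec_add, Matrix.mulVec_smul, Pi.add_apply, Pi.smul_apply, smul_eq_mul]
  ring

theorem mulVec_single_dot {n p : ℕ} (X : Matrix (Fin n) (Fin p) ℝ) (y : Fin n → ℝ) (j : Fin p) :
    ∑ i, (X *ᵥ Pi.single j 1) i * y i = (Xᵀ *ᵥ y) j := by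
  simp [Matrix.mulVec, dotProduct, Matrix.transpose_apply, Pi.single_apply]

theorem card_vecSupport_le {p : ℕ} {u : Fin p → ℝ} {T : Finset (Fin p)}
    (h : ∀ i, i ∉ T → u i = 0) : (vecSupport u).card ≤ T.card := by
  refine Finset.card_le_card fun i hi => ?_
  by_contra hc
  exact (Finset.mem_filter.1 hi).2 (h i hc)

/-- Under the RIP, `n⁻¹ Xᵀ X - I` acts on sparse vectors with entries at most `δ ‖u‖`. -/
theorem RIP.gram_sub_le {n p k : ℕ} {X : Matrix (Fin n) (Fin p) ℝ} {δ : ℝ} (hX : RIP X k δ)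
    {T : Finset (Fin p)} (hT : T.card + 1 ≤ k) {u : Fin p → ℝ} (hu : ∀ i, i ∉ T → u i = 0)
    (j : Fin p) :
    |1 / (n : ℝ) * (Xᵀ *ᵥ (X *ᵥ u)) j - u j| ≤ δ * Real.sqrt (∑ i, u i ^ 2) := by
  classical
  set z := 1 / (n : ℝ) * (Xᵀ *ᵥ (X *ᵥ u)) j with hz
  set N := ∑ i, u i ^ 2 with hN
  have hN0 : 0 ≤ N := Finset.sum_nonneg fun i _ => sq_nonneg _
  -- The upper RIP bound at `e_j + c u` minus the lower one at `e_j - c u`; the vector `e_j`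
  -- accounts for the extra unit of sparsity.
  have key : ∀ c : ℝ, 4 * c * (z - u j) ≤ δ * (2 + 2 * c ^ 2 * N) := by
    intro c
    have hcard : ∀ c : ℝ, (vecSupport (Pi.single j (1 : ℝ) + c • u)).card ≤ k := by
      intro c
      refine (card_vecSupport_le (T := insert j T) ?_).trans
        ((Finset.card_insert_le _ _).trans hT)
      intro i hi
      rw [Finset.mem_insert, not_or] at hi
      simp [hi.1, hu i hi.2]
    have h1 := (hX _ (hcard c)).2
    have h2 := (hX _ (hcard (-c))).1
    have h3 := mulVec_sq_polarization X u (Pi.single j (1 : ℝ)) c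
    rw [mulVec_single_dot] at h3
    have h4 : ∀ c : ℝ, ∑ i, ((Pi.single j (1 : ℝ) : Fin p → ℝ) + c • u) i ^ 2 = 1 + 2 * c * u j + c ^ 2 * N := by
      intro c
      have : ∀ i, ((Pi.single j (1 : ℝ) : Fin p → ℝ) + c • u) i ^ 2 =
          (if i = j then 1 + 2 * c * u j else 0) + c ^ 2 * u i ^ 2 := by
        intro i
        by_cases h : i = j
        · subst h; simp; ring
        · simp [h]; ring
      simp only [this, Finset.sum_add_distrib, ← Finset.mul_sum, Finset.sum_ite_eq',
        Finset.mem_univ, if_true, hN]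
    rw [h4] at h1 h2
    have h5 : 4 * c * z = 1 / (n : ℝ) * ∑ i, (X *ᵥ (Pi.single j (1 : ℝ) + c • u)) i ^ 2 -
        1 / (n : ℝ) * ∑ i, (X *ᵥ (Pi.single j (1 : ℝ) + (-c) • u)) i ^ 2 := by
      rw [← mul_sub, h3, hz]; ring
    nlinarith
  rcases hN0.eq_or_lt with h0 | h0
  · have hu0 : u = 0 := by
      funext i
      have := (Finset.sum_eq_zero_iff_of_nonneg (fun i _ => sq_nonneg (u i))).1
        (hN ▸ h0.symm) i (Finset.mem_univ i)
      simpa using this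
    rw [← h0]
    simp [hz, hu0]
  · have hs : 0 < Real.sqrt N := Real.sqrt_pos.2 h0
    have hsq : Real.sqrt N ^ 2 = N := Real.sq_sqrt hN0
    have hcN : (1 / Real.sqrt N) ^ 2 * N = 1 := by
      rw [div_pow, hsq]; field_simp
    -- `c = 1 / √N` balances the two terms of the bound; the two signs give the two sides of the
    -- absolute value.
    have k1 := key (1 / Real.sqrt N)
    have k2 := key (-(1 / Real.sqrt N))
    have e1 : δ * (2 + 2 * (1 / Real.sqrt N) ^ 2 * N) = 4 * δ := by
      rw [mul_assoc 2, hcN]; ring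
    have e2 : δ * (2 + 2 * (-(1 / Real.sqrt N)) ^ 2 * N) = 4 * δ := by
      rw [neg_sq, mul_assoc 2, hcN]; ring
    rw [e1] at k1
    rw [e2] at k2
    have f1 : 1 / Real.sqrt N * (z - u j) ≤ δ := by linarith
    have f2 : 1 / Real.sqrt N * -(z - u j) ≤ δ := by linarith
    rw [one_div, inv_mul_le_iff₀ hs] at f1 f2
    rw [abs_le]
    constructor <;> linarith

theorem RIP.nonneg {n p k : ℕ} {X : Matrix (Fin n) (Fin p) ℝ} {δ : ℝ} (hX : RIP X k δ)
    (hk : 1 ≤ k) (j : Fin p) : 0 ≤ δ := by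
  have h := hX (Pi.single j 1) ((card_vecSupport_le (T := {j}) (by
    intro i hi; simp at hi; simp [hi])).trans (by simpa using hk))
  have e : ∑ i, (Pi.single j (1 : ℝ) : Fin p → ℝ) i ^ 2 = 1 := by
    simp [Pi.single_apply]
  rw [e] at h
  linarith [h.1, h.2]

theorem RIP.column_le {n p k : ℕ} {X : Matrix (Fin n) (Fin p) ℝ} {δ : ℝ} (hX : RIP X k δ)
    (hk : 1 ≤ k) (j : Fin p) : 1 / (n : ℝ) * ∑ i, X i j ^ 2 ≤ 1 + δ := by
  have h := (hX (Pi.single j 1) ((card_vecSupport_le (T := {j}) (by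
    intro i hi; simp at hi; simp [hi])).trans (by simpa using hk))).2
  have e : ∑ i, (Pi.single j (1 : ℝ) : Fin p → ℝ) i ^ 2 = 1 := by
    simp [Pi.single_apply]
  rw [e] at h
  simpa [Matrix.col_apply] using h

theorem sqrt_sum_sq_le {p : ℕ} {T : Finset (Fin p)} {u : Fin p → ℝ} {D : ℝ} (hD : 0 ≤ D)
    (h0 : ∀ i, i ∉ T → u i = 0) (h : ∀ i ∈ T, |u i| ≤ D) :
    Real.sqrt (∑ i, u i ^ 2) ≤ Real.sqrt T.card * D := by
  have h1 : ∑ i, u i ^ 2 ≤ T.card * D ^ 2 := by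
    rw [← Finset.sum_subset (Finset.subset_univ T) (fun i _ hi => by simp [h0 i hi]),
      ← nsmul_eq_mul]
    refine Finset.sum_le_card_nsmul _ _ _ fun i hi => ?_
    rw [← sq_abs]
    exact pow_le_pow_left₀ (abs_nonneg _) (h i hi) 2
  calc Real.sqrt (∑ i, u i ^ 2) ≤ Real.sqrt (T.card * D ^ 2) := Real.sqrt_le_sqrt h1
    _ = Real.sqrt T.card * D := by rw [Real.sqrt_mul (by positivity), Real.sqrt_sq hD]

/-- Under the RIP, the gradient of the loss at `v` is `v - θ` up to a small perturbation, when the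
truth is `θ + ω` with `θ` supported on `S₁` and `ω` small and supported on `S \ S₁`. -/
theorem RIP.residual_sub_le {n p : ℕ} {X : Matrix (Fin n) (Fin p) ℝ} {δ : ℝ}
    {S S₁ : Finset (Fin p)} (hX : RIP X (S.card + 1) δ) (hS₁ : S₁ ⊆ S) (hS : 1 ≤ S.card)
    {θ ω v : Fin p → ℝ} {y w : Fin n → ℝ} {D M W A : ℝ} (hδ : 0 ≤ δ)
    (hy : y = X *ᵥ (θ + ω) + w)
    (hθ : ∀ i, i ∉ S₁ → θ i = 0) (hω : ∀ i, i ∉ S → ω i = 0) (hW : ∀ i, |ω i| ≤ W) (hD0 : 0 ≤ D)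
    (hM0 : 0 ≤ M)
    (hD : ∀ i ∈ S₁, |v i - θ i| ≤ D) (hM : ∀ i, i ∉ S₁ → |v i| ≤ M) (j : Fin p)
    (hA : |1 / (n : ℝ) * (Xᵀ *ᵥ w) j| ≤ A) :
    |1 / (n : ℝ) * (Xᵀ *ᵥ (X *ᵥ v - y)) j - (v j - θ j)| ≤
      δ * (Real.sqrt S.card * D) + δ * (p * M) + (δ * (Real.sqrt S.card * W) + W) + A := by
  classical
  have hW0 : 0 ≤ W := (abs_nonneg _).trans (hW j)
  set h₁ : Fin p → ℝ := fun i => if i ∈ S₁ then v i - θ i else 0 with hh1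
  set h₂ : Fin p → ℝ := fun i => if i ∈ S₁ then 0 else v i with hh2
  have hsum : v = θ + h₁ + h₂ := by
    funext i
    by_cases hi : i ∈ S₁ <;> simp [hh1, hh2, hi, hθ]
  have b1 : |1 / (n : ℝ) * (Xᵀ *ᵥ (X *ᵥ h₁)) j - h₁ j| ≤ δ * (Real.sqrt S.card * D) := by
    have hz : ∀ i, i ∉ S → h₁ i = 0 := fun i hi =>
      if_neg fun h => hi (hS₁ h)
    refine (hX.gram_sub_le le_rfl hz j).trans (mul_le_mul_of_nonneg_left ?_ hδ)
    refine sqrt_sum_sq_le hD0 hz fun i _ => ?_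
    by_cases hi : i ∈ S₁
    · simpa [hh1, hi] using hD i hi
    · simpa [hh1, hi] using hD0
  have b3 : |1 / (n : ℝ) * (Xᵀ *ᵥ (X *ᵥ ω)) j - ω j| ≤ δ * (Real.sqrt S.card * W) :=
    (hX.gram_sub_le le_rfl hω j).trans (mul_le_mul_of_nonneg_left
      (sqrt_sum_sq_le hW0 hω fun i _ => hW i) hδ)
  -- `h₂` is not sparse, so it is split into `p` one-sparse vectors; the factor `p` is later paid
  -- for by `α p ≤ 1 / 2`.
  have b2 : |1 / (n : ℝ) * (Xᵀ *ᵥ (X *ᵥ h₂)) j - h₂ j| ≤ δ * (p * M) := by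
    have hdec : h₂ = ∑ i, Pi.single i (h₂ i) := (Finset.univ_sum_single h₂).symm
    have e1 : (Xᵀ *ᵥ (X *ᵥ h₂)) j = ∑ i, (Xᵀ *ᵥ (X *ᵥ Pi.single i (h₂ i))) j := by
      conv_lhs => rw [hdec]
      rw [Matrix.mulVec_sum, Matrix.mulVec_sum, Finset.sum_apply]
    have e2 : h₂ j = ∑ i, (Pi.single i (h₂ i) : Fin p → ℝ) j := by
      conv_lhs => rw [hdec]
      rw [Finset.sum_apply]
    rw [e1, e2, Finset.mul_sum, ← Finset.sum_sub_distrib]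
    refine (Finset.abs_sum_le_sum_abs _ _).trans ?_
    have hcard : ((Finset.univ : Finset (Fin p)).card : ℝ) = p := by simp
    calc ∑ i, |1 / (n : ℝ) * (Xᵀ *ᵥ (X *ᵥ Pi.single i (h₂ i))) j -
          (Pi.single i (h₂ i) : Fin p → ℝ) j| ≤
          (Finset.univ : Finset (Fin p)).card • (δ * M) := by
          refine Finset.sum_le_card_nsmul _ _ _ fun i _ => ?_
          have hz : ∀ k, k ∉ ({i} : Finset (Fin p)) → (Pi.single i (h₂ i) : Fin p → ℝ) k = 0 := by
            intro k hk
            simp at hk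
            simp [hk]
          refine (hX.gram_sub_le (T := {i}) (by simpa using hS) hz j).trans
            (mul_le_mul_of_nonneg_left ?_ hδ)
          refine (sqrt_sum_sq_le (T := {i}) hM0 hz ?_).trans (by simp)
          intro k hk
          rw [Finset.mem_singleton] at hk
          subst hk
          rw [Pi.single_eq_same]
          by_cases hi : k ∈ S₁
          · simpa [hh2, hi] using hM0
          · simpa [hh2, hi] using hM k hi
      _ = δ * (p * M) := by rw [nsmul_eq_mul, hcard]; ring
  have hdecomp : 1 / (n : ℝ) * (Xᵀ *ᵥ (X *ᵥ v - y)) j - (v j - θ j) =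
      (1 / (n : ℝ) * (Xᵀ *ᵥ (X *ᵥ h₁)) j - h₁ j) + (1 / (n : ℝ) * (Xᵀ *ᵥ (X *ᵥ h₂)) j - h₂ j) -
      ((1 / (n : ℝ) * (Xᵀ *ᵥ (X *ᵥ ω)) j - ω j) + ω j) - 1 / (n : ℝ) * (Xᵀ *ᵥ w) j := by
    have hv : X *ᵥ v - y = X *ᵥ h₁ + X *ᵥ h₂ - X *ᵥ ω - w := by
      rw [hy, hsum]
      simp only [Matrix.mulVec_add]
      abel
    have hvj : v j = θ j + h₁ j + h₂ j := by
      conv_lhs => rw [hsum]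
      rfl
    rw [hv, hvj]
    simp only [Matrix.mulVec_add, Matrix.mulVec_sub, Pi.add_apply, Pi.sub_apply]
    ring
  rw [hdecomp, abs_le]
  obtain ⟨p1, p2⟩ := abs_le.1 b1
  obtain ⟨p3, p4⟩ := abs_le.1 b2
  obtain ⟨p5, p6⟩ := abs_le.1 b3
  obtain ⟨p7, p8⟩ := abs_le.1 (hW j)
  obtain ⟨p9, p10⟩ := abs_le.1 hA
  constructor <;> linarith

/-! ### Tail bound for the noise. -/

theorem hasSubgaussianMGF_gaussianReal {Ω : Type*} [MeasurableSpace Ω] {P : Measure Ω}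
    [NeZero P] {Z : Ω → ℝ} {v : NNReal} (hZ : P.map Z = gaussianReal 0 v) :
    HasSubgaussianMGF Z v P where
  integrable_exp_mul t := by
    rw [← mgf_pos_iff, mgf_gaussianReal hZ]
    positivity
  mgf_le t := by
    rw [mgf_gaussianReal hZ]
    simp

theorem HasSubgaussianMGF.mono {Ω : Type*} [MeasurableSpace Ω] {P : Measure Ω} {Z : Ω → ℝ}
    {c d : NNReal} (h : HasSubgaussianMGF Z c P) (hcd : c ≤ d) : HasSubgaussianMGF Z d P where
  integrable_exp_mul := h.integrable_exp_mul
  mgf_le t := (h.mgf_le t).trans (Real.exp_le_exp.2 (by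
    have : (c : ℝ) ≤ d := hcd
    gcongr))

theorem gaussianNoise_eq (n : ℕ) (σ : ℝ) :
    gaussianNoise n σ = Measure.pi fun _ => gaussianReal 0 (Real.toNNReal (σ ^ 2)) := by
  have h : (⟨σ ^ 2, sq_nonneg σ⟩ : NNReal) = Real.toNNReal (σ ^ 2) :=
    (Real.toNNReal_of_nonneg (sq_nonneg σ)).symm
  unfold gaussianNoise
  exact congrArg (fun v : NNReal => Measure.pi fun _ : Fin n => gaussianReal 0 v) h

instance (n : ℕ) (σ : ℝ) : IsProbabilityMeasure (gaussianNoise n σ) := by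
  rw [gaussianNoise_eq]; infer_instance

theorem hasSubgaussianMGF_linear_gaussianNoise {n : ℕ} (σ : ℝ) (r : Fin n → ℝ) {d : NNReal}
    (hd : σ ^ 2 * ∑ i, r i ^ 2 ≤ d) :
    HasSubgaussianMGF (fun w : Fin n → ℝ => ∑ i, r i * w i) d (gaussianNoise n σ) := by
  have hind : iIndepFun (fun (i : Fin n) (w : Fin n → ℝ) => r i * w i) (gaussianNoise n σ) := by
    rw [gaussianNoise_eq]
    exact iIndepFun_pi (X := fun i x => r i * x) fun i => by fun_prop
  have hsub : ∀ i ∈ (Finset.univ : Finset (Fin n)), HasSubgaussianMGF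
      (fun w : Fin n → ℝ => r i * w i) (⟨r i ^ 2, sq_nonneg _⟩ * Real.toNNReal (σ ^ 2))
      (gaussianNoise n σ) := by
    intro i _
    refine HasSubgaussianMGF.const_mul (hasSubgaussianMGF_gaussianReal ?_) (r i)
    rw [gaussianNoise_eq]
    exact (measurePreserving_eval
      (fun _ : Fin n => gaussianReal 0 (Real.toNNReal (σ ^ 2))) i).map_eq
  refine HasSubgaussianMGF.mono (HasSubgaussianMGF.sum_of_iIndepFun hind hsub) ?_
  rw [← NNReal.coe_le_coe, NNReal.coe_sum]
  refine le_trans (le_of_eq ?_) hd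
  rw [Finset.mul_sum]
  refine Finset.sum_congr rfl fun i _ => ?_
  change r i ^ 2 * (Real.toNNReal (σ ^ 2) : ℝ) = _
  rw [Real.coe_toNNReal _ (sq_nonneg σ), mul_comm]

/-- With high probability all entries of `n⁻¹ Xᵀ w` are at most `4 σ √(log p / n)`. -/
theorem gaussianNoise_transpose_mulVec_le {n p : ℕ} (hn : 1 ≤ n) (hp : 2 ≤ p)
    {X : Matrix (Fin n) (Fin p) ℝ} {σ : ℝ} (hσ : 0 < σ)
    (hX : ∀ j, 1 / (n : ℝ) * ∑ i, X i j ^ 2 ≤ 2) :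
    (gaussianNoise n σ).real {w | ∀ j, |1 / (n : ℝ) * (Xᵀ *ᵥ w) j| ≤
      4 * σ * Real.sqrt (Real.log p / n)}ᶜ ≤ (p : ℝ) ^ (-1 : ℝ) := by
  have hn0 : (0 : ℝ) < n := by exact_mod_cast hn
  have hp2 : (2 : ℝ) ≤ p := by exact_mod_cast hp
  have hlog : 0 ≤ Real.log p := Real.log_nonneg (by linarith)
  set ε := 4 * σ * Real.sqrt (Real.log p / n) with hε
  have hε0 : 0 ≤ ε := by positivity
  obtain ⟨d, hd⟩ : ∃ d : NNReal, (d : ℝ) = 2 * σ ^ 2 / n := ⟨Real.toNNReal _, Real.coe_toNNReal _ (by positivity)⟩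
  -- The exponent is `16 / 4 = 4` times `log p`. The union bound over `2p` tails then gives `2 p⁻³ ≤
  -- p⁻¹` for `p ≥ 2`.
  have hexp : Real.exp (-ε ^ 2 / (2 * (d : ℝ))) = ((p : ℝ) ^ 4)⁻¹ := by
    have h1 : -ε ^ 2 / (2 * (d : ℝ)) = -(4 * Real.log p) := by
      rw [hd, hε, mul_pow, Real.sq_sqrt (by positivity)]
      field_simp
      ring
    rw [h1, Real.exp_neg, mul_comm, Real.exp_mul, Real.exp_log (by linarith)]
    norm_cast
  have htail : ∀ r : Fin n → ℝ, σ ^ 2 * ∑ i, r i ^ 2 ≤ d →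
      (gaussianNoise n σ).real {w | ε ≤ ∑ i, r i * w i} ≤ ((p : ℝ) ^ 4)⁻¹ := by
    intro r hr
    rw [← hexp]
    exact (hasSubgaussianMGF_linear_gaussianNoise σ r hr).measure_ge_le hε0
  have hvar : ∀ j, ∀ c : ℝ, c ^ 2 = 1 → σ ^ 2 * ∑ i, (c * (1 / (n : ℝ) * X i j)) ^ 2 ≤ d := by
    intro j c hc
    have h1 : σ ^ 2 * ∑ i, (c * (1 / (n : ℝ) * X i j)) ^ 2 =
        σ ^ 2 / n * (1 / (n : ℝ) * ∑ i, X i j ^ 2) := by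
      simp only [mul_pow, hc, one_mul, ← Finset.mul_sum]
      field_simp
    rw [h1]
    calc σ ^ 2 / (n : ℝ) * (1 / (n : ℝ) * ∑ i, X i j ^ 2) ≤ σ ^ 2 / n * 2 := by gcongr; exact hX j
      _ = (d : ℝ) := by rw [hd]; ring
  have hsub : {w | ∀ j, |1 / (n : ℝ) * (Xᵀ *ᵥ w) j| ≤ ε}ᶜ ⊆
      ⋃ j : Fin p, ({w | ε ≤ ∑ i, (1 * (1 / (n : ℝ) * X i j)) * w i} ∪
        {w | ε ≤ ∑ i, (-1 * (1 / (n : ℝ) * X i j)) * w i}) := by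
    intro w hw
    simp only [Set.mem_compl_iff, Set.mem_ofPred_eq, not_forall, not_le] at hw
    obtain ⟨j, hj⟩ := hw
    have e : ∀ c : ℝ, ∑ i, (c * (1 / (n : ℝ) * X i j)) * w i =
        c * (1 / (n : ℝ) * (Xᵀ *ᵥ w) j) := by
      intro c
      simp only [Matrix.mulVec, dotProduct, Matrix.transpose_apply, Finset.mul_sum]
      exact Finset.sum_congr rfl fun i _ => by ring
    refine Set.mem_iUnion.2 ⟨j, ?_⟩
    simp only [Set.mem_union, Set.mem_ofPred_eq, e]
    rcases lt_abs.1 hj with h | h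
    · left; linarith
    · right; linarith
  calc _ ≤ (gaussianNoise n σ).real (⋃ j : Fin p,
        ({w | ε ≤ ∑ i, (1 * (1 / (n : ℝ) * X i j)) * w i} ∪
        {w | ε ≤ ∑ i, (-1 * (1 / (n : ℝ) * X i j)) * w i})) := measureReal_mono hsub
    _ ≤ ∑ j : Fin p, (gaussianNoise n σ).real
        ({w | ε ≤ ∑ i, (1 * (1 / (n : ℝ) * X i j)) * w i} ∪
        {w | ε ≤ ∑ i, (-1 * (1 / (n : ℝ) * X i j)) * w i}) := measureReal_iUnion_fintype_le _
    _ ≤ ∑ _j : Fin p, 2 * ((p : ℝ) ^ 4)⁻¹ := by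
        refine Finset.sum_le_sum fun j _ => (measureReal_union_le _ _).trans ?_
        have h1 := htail _ (hvar j 1 (by norm_num))
        have h2 := htail _ (hvar j (-1) (by norm_num))
        linarith
    _ ≤ (p : ℝ) ^ (-1 : ℝ) := by
        rw [Finset.sum_const, Finset.card_univ, Fintype.card_fin, nsmul_eq_mul, Real.rpow_neg_one]
        have h3 : (0 : ℝ) < p := by linarith
        rw [inv_eq_one_div, inv_eq_one_div, le_div_iff₀ h3]
        have : (p : ℝ) * (2 * (1 / (p : ℝ) ^ 4)) * p = 2 / p ^ 2 := by field_simp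
        rw [this, div_le_one (by positivity)]
        nlinarith

/-! ### Error envelope and the coupled dynamics. -/

/-- The envelope of the error on the strong coordinates: constant up to time `T₁`, then
geometrically decaying down to `4 T`. -/
noncomputable def errEnvelope (K T η m : ℝ) (T₁ u : ℕ) : ℝ :=
  if u < T₁ then K else K * (1 - η * m / 2) ^ (u - T₁) + 4 * T

theorem errEnvelope_nonneg {K T η m : ℝ} (hK : 0 ≤ K) (hT : 0 ≤ T) (hηm : η * m ≤ 1) (T₁ u : ℕ) :
    0 ≤ errEnvelope K T η m T₁ u := by
  have : 0 ≤ 1 - η * m / 2 := by linarith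
  unfold errEnvelope
  split_ifs <;> positivity

theorem errEnvelope_le {K T η m : ℝ} (hK : 0 ≤ K) (hT : 0 ≤ T) (hηm0 : 0 ≤ η * m)
    (hηm : η * m ≤ 1) (T₁ u : ℕ) : errEnvelope K T η m T₁ u ≤ K + 4 * T := by
  unfold errEnvelope
  split_ifs
  · linarith
  · have : (1 - η * m / 2) ^ (u - T₁) ≤ 1 := pow_le_one₀ (by linarith) (by linarith)
    have := mul_le_mul_of_nonneg_left this hK
    linarith

/-- The accumulated envelope: `T₁` steps at level `K`, then a geometric series. -/
theorem sum_errEnvelope_le {K T η m : ℝ} (hK : 0 ≤ K) (hT : 0 ≤ T) (hηm0 : 0 < η * m)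
    (hηm : η * m ≤ 1) (T₁ t : ℕ) :
    ∑ u ∈ Finset.range t, errEnvelope K T η m T₁ u ≤ T₁ * K + 2 * K / (η * m) + t * (4 * T) := by
  set x := 1 - η * m / 2 with hx
  have hx0 : 0 ≤ x := by rw [hx]; linarith
  have key : ∀ u ∈ Finset.range t, errEnvelope K T η m T₁ u ≤
      (if u < T₁ then K else 0) + (if T₁ ≤ u then K * x ^ (u - T₁) else 0) + 4 * T := by
    intro u _
    unfold errEnvelope
    by_cases h : u < T₁
    · simp only [h, if_true, not_le.2 h, if_false]; linarith
    · simp only [h, if_false, not_lt.1 h, if_true]; linarith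
  refine (Finset.sum_le_sum key).trans ?_
  rw [Finset.sum_add_distrib, Finset.sum_add_distrib, Finset.sum_const, Finset.card_range,
    nsmul_eq_mul]
  gcongr
  · rw [← Finset.sum_filter, Finset.sum_const, nsmul_eq_mul]
    have : (Finset.range t |>.filter (· < T₁)).card ≤ T₁ := by
      refine (Finset.card_le_card (t := Finset.range T₁) fun u hu => ?_).trans
        (Finset.card_range _).le
      exact Finset.mem_range.2 (Finset.mem_filter.1 hu).2
    gcongr
  · rw [← Finset.sum_filter]
    calc ∑ u ∈ Finset.range t with T₁ ≤ u, K * x ^ (u - T₁)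
        ≤ ∑ k ∈ Finset.range t, K * x ^ k := by
          rw [← Finset.sum_image (f := fun k => K * x ^ k) (g := fun u => u - T₁)
            (s := Finset.range t |>.filter (T₁ ≤ ·))]
          · refine Finset.sum_le_sum_of_subset_of_nonneg ?_ fun _ _ _ => by positivity
            intro k hk
            simp only [Finset.mem_image, Finset.mem_filter, Finset.mem_range] at hk ⊢
            omega
          · intro u hu v hv huv
            simp only [Finset.coe_filter, Finset.mem_range, Set.mem_ofPred_eq] at hu hv
            simp only at huv
            omega
      _ = K * ∑ k ∈ Finset.range t, x ^ k := by rw [Finset.mul_sum]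
      _ ≤ K * (2 / (η * m)) := by
          gcongr
          have h1 := mul_neg_geom_sum x t
          have h2 : 1 - x = η * m / 2 := by rw [hx]; ring
          rw [h2] at h1
          rw [le_div_iff₀ hηm0]
          have : 0 ≤ x ^ t := by positivity
          linarith
      _ = 2 * K / (η * m) := by ring

/-- Before `T₁` the envelope is just `θ ≤ K`. From `T₁` on, `StrongState.half` applies, so `(a² +
b²) / 2 ≥ θ ≥ m` and the error contracts at rate at least `η m / 2` down to the floor. -/
theorem StrongState.update {a b α θ η e m K T ε : ℝ} {T₁ u : ℕ}
    (h : StrongState α θ (α * (1 + η * m / 4) ^ u) (errEnvelope K T η m T₁ u) a b)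
    (hα : 0 < α) (hm : 0 < m) (hmθ : m ≤ θ) (hθK : θ ≤ K) (hαm : α ^ 2 ≤ m) (hη : 0 < η)
    (hηK : η * K ≤ 1 / 1000) (hT : 0 ≤ T) (hε1 : ε ≤ 1 / 1000)
    (hT₁ : 2 * K + α ^ 2 < (α * (1 + η * m / 4) ^ T₁) ^ 2)
    (he : |e| ≤ ε * errEnvelope K T η m T₁ u + T)
    (hem : ε * errEnvelope K T η m T₁ u + T ≤ m / 16) :
    StrongState α θ (α * (1 + η * m / 4) ^ (u + 1)) (errEnvelope K T η m T₁ (u + 1))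
      (a * (1 - η * ((a ^ 2 - b ^ 2) / 4 - θ + e)))
      (b * (1 + η * ((a ^ 2 - b ^ 2) / 4 - θ + e))) := by
  have hηθ : η * θ ≤ 1 / 1000 := (mul_le_mul_of_nonneg_left hθK hη.le).trans hηK
  have hηm : η * m ≤ 1 / 1000 := (mul_le_mul_of_nonneg_left hmθ hη.le).trans hηθ
  have hηm0 : 0 < η * m := mul_pos hη hm
  have hθ : 0 < θ := hm.trans_le hmθ
  have hK : 0 < K := hθ.trans_le hθK
  have hem' : |e| ≤ m / 16 := he.trans hem
  rw [pow_succ, ← mul_assoc]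
  refine h.step hm hmθ (hαm.trans hmθ) hη hηθ hem' fun h1 h2 => ?_
  rcases lt_or_ge u T₁ with hu | hu
  · refine h1.trans (hθK.trans ?_)
    unfold errEnvelope
    split_ifs with h3
    · exact le_rfl
    · have : u + 1 - T₁ = 0 := by omega
      rw [this, pow_zero]
      linarith
  · have hg : (α * (1 + η * m / 4) ^ T₁) ^ 2 ≤ (α * (1 + η * m / 4) ^ u) ^ 2 := by
      have : (1 : ℝ) ≤ 1 + η * m / 4 := by linarith
      gcongr
    have hhalf := h.half (by linarith) (by positivity)
    have hq : m ≤ (a ^ 2 + b ^ 2) / 2 := by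
      nlinarith [(abs_le.1 hhalf).1, sq_nonneg b]
    have hηq := (strong_coordinate_step h.a_pos h.b_pos h.mul_le hθ (hαm.trans hmθ) hη hηθ
      (by linarith : |e| ≤ θ / 16) h.err_le).2.2.2.2.1
    have henv : errEnvelope K T η m T₁ u = K * (1 - η * m / 2) ^ (u - T₁) + 4 * T :=
      if_neg (by omega)
    have henv' : errEnvelope K T η m T₁ (u + 1) =
        K * (1 - η * m / 2) ^ (u - T₁) * (1 - η * m / 2) + 4 * T := by
      rw [errEnvelope, if_neg (by omega), mul_assoc, ← pow_succ]
      congr 3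
      omega
    rw [henv']
    have hx : 0 ≤ 1 - η * m / 2 := by linarith
    exact envelope_step hq hm hη hηq hε1 (by positivity) hT (henv ▸ h.err_le_env) (henv ▸ he) h2

/-- The dynamics of `a = g + l`, `b = g - l` under a gradient that is `β - θ` up to an error
controlled by the error on the strong coordinates: at late times the strong coordinates are close
to their targets and the others are still of order `α²`. -/
theorem signal_recovery_of_dynamics {p : ℕ} {S₁ : Finset (Fin p)} {θ : Fin p → ℝ}
    {a b e : ℕ → Fin p → ℝ} {α η m K T ε : ℝ} {T₁ t : ℕ}
    (ha0 : ∀ j, a 0 j = α) (hb0 : ∀ j, b 0 j = α)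
    (ha : ∀ u j, a (u + 1) j =
      a u j * (1 - η * ((a u j ^ 2 - b u j ^ 2) / 4 - θ j + e u j)))
    (hb : ∀ u j, b (u + 1) j =
      b u j * (1 + η * ((a u j ^ 2 - b u j ^ 2) / 4 - θ j + e u j)))
    (hθ0 : ∀ j, j ∉ S₁ → θ j = 0) (hθm : ∀ j ∈ S₁, m ≤ |θ j|) (hθK : ∀ j, |θ j| ≤ K)
    (he : ∀ u D, 0 ≤ D → (∀ j ∈ S₁, |(a u j ^ 2 - b u j ^ 2) / 4 - θ j| ≤ D) →
      (∀ j, j ∉ S₁ → |(a u j ^ 2 - b u j ^ 2) / 4| ≤ 2 * α ^ 2) → ∀ j, |e u j| ≤ ε * D + T)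
    (hα : 0 < α) (hα1 : α ≤ 1 / 3) (hαm : α ^ 2 ≤ m) (hm : 0 < m) (hmK : m ≤ K) (hη : 0 < η)
    (hη1 : η ≤ 1 / 2) (hηK : η * K ≤ 1 / 1000) (hT : 0 ≤ T) (hTm : T ≤ m / 64) (hε : 0 ≤ ε)
    (hε1 : ε ≤ 1 / 1000) (hεK : ε * K ≤ m / 64)
    (hT₁ : 2 * K + α ^ 2 < (α * (1 + η * m / 4) ^ T₁) ^ 2) (hT₁t : T₁ ≤ t)
    (hsum : η * ∑ u ∈ Finset.range t, (ε * errEnvelope K T η m T₁ u + T) ≤ 1) :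
    (∀ j ∈ S₁, |(a t j ^ 2 - b t j ^ 2) / 4 - θ j| ≤ |θ j| / 2) ∧
      ∀ j, j ∉ S₁ → |(a t j ^ 2 - b t j ^ 2) / 4| ≤ 2 * α ^ 2 := by
  have hηm : η * m ≤ 1 / 1000 := (mul_le_mul_of_nonneg_left hmK hη.le).trans hηK
  have hηm0 : 0 < η * m := mul_pos hη hm
  have hK : 0 < K := hm.trans_le hmK
  set F := errEnvelope K T η m T₁ with hF
  have hF0 : ∀ u, 0 ≤ F u := errEnvelope_nonneg hK.le hT (by linarith) T₁
  have hFle : ∀ u, F u ≤ K + 4 * T := errEnvelope_le hK.le hT hηm0.le (by linarith) T₁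
  set E : ℕ → ℝ := fun u => ε * F u + T with hE
  have hE0 : ∀ u, 0 ≤ E u := fun u => add_nonneg (mul_nonneg hε (hF0 u)) hT
  have hEm : ∀ u, E u ≤ m / 16 := by
    intro u
    have h1 : ε * F u ≤ ε * (K + 4 * T) := mul_le_mul_of_nonneg_left (hFle u) hε
    have h2 : ε * (4 * T) ≤ 1 / 1000 * (4 * T) := by gcongr
    have : E u = ε * F u + T := rfl
    linarith
  set A : ℕ → ℝ := fun u => η * ∑ v ∈ Finset.range u, E v with hA
  have hA1 : ∀ u ≤ t, A u ≤ 1 := fun u hu => le_trans (mul_le_mul_of_nonneg_left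
    (Finset.sum_le_sum_of_subset_of_nonneg (Finset.range_mono hu) fun v _ _ => hE0 v) hη.le) hsum
  -- Total growth is at most `e`, and `e² / 4 < 2` is the source of the bound `2 α²`.
  have hexp : ∀ u ≤ t, Real.exp (A u) ≤ 2.7182818286 := fun u hu =>
    (Real.exp_le_exp.2 (hA1 u hu)).trans Real.exp_one_lt_d9.le
  have hsmall : ∀ u ≤ t, ∀ x y : ℝ, 0 < x → 0 < y → x ≤ α * Real.exp (A u) →
      y ≤ α * Real.exp (A u) → |(x ^ 2 - y ^ 2) / 4| ≤ 2 * α ^ 2 := by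
    intro u hu x y hx hy hxA hyA
    have h3 : α * Real.exp (A u) ≤ α * 2.7182818286 :=
      mul_le_mul_of_nonneg_left (hexp u hu) hα.le
    have h1 : x ^ 2 ≤ (α * 2.7182818286) ^ 2 := pow_le_pow_left₀ hx.le (hxA.trans h3) 2
    have h2 : y ^ 2 ≤ (α * 2.7182818286) ^ 2 := pow_le_pow_left₀ hy.le (hyA.trans h3) 2
    rw [abs_le]
    constructor <;> nlinarith [sq_nonneg x, sq_nonneg y, sq_nonneg α]
  have inv : ∀ u ≤ t,
      (∀ j ∈ S₁,
        (0 < θ j ∧ StrongState α (θ j) (α * (1 + η * m / 4) ^ u) (F u) (a u j) (b u j)) ∨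
        (θ j < 0 ∧ StrongState α (-θ j) (α * (1 + η * m / 4) ^ u) (F u) (b u j) (a u j))) ∧
      ∀ j, j ∉ S₁ → 0 < a u j ∧ 0 < b u j ∧ a u j ≤ α * Real.exp (A u) ∧
        b u j ≤ α * Real.exp (A u) := by
    intro u
    induction u with
    | zero =>
      intro _
      have hK0 : K ≤ F 0 := by
        rw [hF, errEnvelope]
        split_ifs
        · exact le_rfl
        · simp only [Nat.zero_sub, pow_zero]; linarith
      have init : ∀ x : ℝ, 0 < x → x ≤ K →
          StrongState α x (α * (1 + η * m / 4) ^ 0) (F 0) α α := by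
        intro x hx hxK
        have h0 : (α ^ 2 - α ^ 2) / 4 - x = -x := by ring
        have h1 : |(α ^ 2 - α ^ 2) / 4 - x| = x := by rw [h0, abs_neg, abs_of_pos hx]
        refine ⟨hα, hα, by rw [sq], h1.le, h1.le.trans (hxK.trans hK0), Or.inr ⟨?_, by simp⟩⟩
        rw [h0]
        linarith
      refine ⟨fun j hj => ?_, fun j _ => ?_⟩
      · rw [ha0, hb0]
        have hθj : 0 < |θ j| := hm.trans_le (hθm j hj)
        rcases lt_or_gt_of_ne (abs_pos.1 hθj) with h | h
        · exact Or.inr ⟨h, init _ (by linarith) ((neg_le_abs _).trans (hθK j))⟩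
        · exact Or.inl ⟨h, init _ h ((le_abs_self _).trans (hθK j))⟩
      · rw [ha0, hb0]
        simp [hA, hα]
    | succ u ih =>
      intro hu
      obtain ⟨ih1, ih2⟩ := ih (by omega)
      -- Here the two halves of the induction meet: the perturbation at time `u` is controlled by
      -- the strong and the null bounds together.
      have herr : ∀ j, |e u j| ≤ ε * F u + T := by
        refine he u (F u) (hF0 u) (fun j hj => ?_) fun j hj => ?_
        · rcases ih1 j hj with ⟨_, h⟩ | ⟨_, h⟩
          · exact h.err_le_env
          · have e1 : (a u j ^ 2 - b u j ^ 2) / 4 - θ j =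
                -((b u j ^ 2 - a u j ^ 2) / 4 - -θ j) := by ring
            rw [e1, abs_neg]
            exact h.err_le_env
        · obtain ⟨h1, h2, h3, h4⟩ := ih2 j hj
          exact hsmall u (by omega) _ _ h1 h2 h3 h4
      refine ⟨fun j hj => ?_, fun j hj => ?_⟩
      · rw [ha, hb]
        rcases ih1 j hj with ⟨h0, h⟩ | ⟨h0, h⟩
        · refine Or.inl ⟨h0, h.update hα hm ?_ ((le_abs_self _).trans (hθK j)) hαm hη hηK hT hε1
            hT₁ (herr j) (hEm u)⟩
          rw [← abs_of_pos h0]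
          exact hθm j hj
        -- Swapping `a` and `b` and negating `θ` and `e` leaves the recursion unchanged.
        · refine Or.inr ⟨h0, ?_⟩
          have := h.update (e := -e u j) hα hm (by rw [← abs_of_neg h0]; exact hθm j hj)
            ((neg_le_abs _).trans (hθK j)) hαm hη hηK hT hε1 hT₁
            (by rw [abs_neg]; exact herr j) (hEm u)
          convert this using 1 <;> ring
      · obtain ⟨h1, h2, h3, h4⟩ := ih2 j hj
        have hbound : α * Real.exp (A u) ≤ 1 := by
          have := hexp u (by omega)
          have h5 : α * Real.exp (A u) ≤ 1 / 3 * 2.7182818286 := by gcongr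
          linarith
        have hηE : η * E u ≤ 1 / 1000 :=
          (mul_le_mul_of_nonneg_left ((hEm u).trans (by linarith : m / 16 ≤ m)) hη.le).trans hηm
        obtain ⟨k1, k2, k3, k4⟩ :=
          null_coordinate_step h1 h2 h3 h4 hbound hη hη1 (herr j) (by
            change η * E u < 1 / 2
            linarith)
        have hstep : α * Real.exp (A u) * (1 + η * (ε * F u + T)) ≤ α * Real.exp (A (u + 1)) := by
          have e1 : A (u + 1) = A u + η * (ε * F u + T) := by
            simp only [hA, hE, Finset.sum_range_succ, mul_add]
          rw [e1, Real.exp_add, mul_assoc]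
          gcongr
          linarith [Real.add_one_le_exp (η * (ε * F u + T))]
        rw [ha, hb, hθ0 j hj, sub_zero]
        exact ⟨k1, k2, k3.trans hstep, k4.trans hstep⟩
  obtain ⟨f1, f2⟩ := inv t le_rfl
  have hg : (α * (1 + η * m / 4) ^ T₁) ^ 2 ≤ (α * (1 + η * m / 4) ^ t) ^ 2 := by
    have : (1 : ℝ) ≤ 1 + η * m / 4 := by linarith
    gcongr
  refine ⟨fun j hj => ?_, fun j hj => ?_⟩
  · have hK' := hθK j
    rcases f1 j hj with ⟨h0, h⟩ | ⟨h0, h⟩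
    · rw [abs_of_pos h0] at hK' ⊢
      exact h.half (by linarith) (by positivity)
    · rw [abs_of_neg h0] at hK' ⊢
      have e1 : (a t j ^ 2 - b t j ^ 2) / 4 - θ j =
          -((b t j ^ 2 - a t j ^ 2) / 4 - -θ j) := by ring
      rw [e1, abs_neg]
      exact h.half (by linarith) (by positivity)
  · obtain ⟨h1, h2, h3, h4⟩ := f2 j hj
    exact hsmall t le_rfl _ _ h1 h2 h3 h4

/-! ### Minimal strength and growth time. -/

/-- If a strong `j` were below `m`, the at least `s₁` indices reaching `m` would all be strong,
since larger entries are strong too, and different from `j`: too many. -/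
theorem minStrength_le {n p : ℕ} {σ : ℝ} {β : Fin p → ℝ} {j : Fin p}
    (hj : j ∈ strongSignals n σ β) : minStrength n σ β ≤ |β j| := by
  classical
  have hk : 1 ≤ (strongSignals n σ β).card := Finset.card_pos.2 ⟨j, hj⟩
  have hkp : (strongSignals n σ β).card ≤ p := (Finset.card_le_univ _).trans (by simp)
  have h1 := (kthLargestAbs_isGreatest hk hkp β).1
  by_contra! hlt
  have hsub : (Finset.univ.filter fun i => minStrength n σ β ≤ |β i|) ⊆
      (strongSignals n σ β).erase j := by
    intro i hi
    have hi' := (Finset.mem_filter.1 hi).2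
    have hij : |β j| < |β i| := hlt.trans_le hi'
    have hj2 := (Finset.mem_filter.1 hj).2
    refine Finset.mem_erase.2 ⟨fun h => by rw [h] at hij; exact lt_irrefl _ hij, ?_⟩
    refine Finset.mem_filter.2 ⟨Finset.mem_filter.2 ⟨Finset.mem_univ _, ?_⟩, hj2.trans hij.le⟩
    exact abs_pos.1 ((abs_nonneg _).trans_lt hij)
  have h2 := Finset.card_le_card hsub
  rw [Finset.card_erase_of_mem hj] at h2
  have h3 : (strongSignals n σ β).card ≤
      (Finset.univ.filter fun i => minStrength n σ β ≤ |β i|).card := h1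
  omega

theorem minStrength_pos {n p : ℕ} {σ : ℝ} {β : Fin p → ℝ} (h : (strongSignals n σ β).Nonempty) :
    0 < minStrength n σ β := by
  have hkp : (strongSignals n σ β).card ≤ p := (Finset.card_le_univ _).trans (by simp)
  obtain ⟨i, hi, hmin⟩ := Finset.exists_min_image _ (fun i => |β i|) h
  have h2 := (kthLargestAbs_isGreatest (Finset.card_pos.2 h) hkp β).2
  have hi0 : 0 < |β i| := abs_pos.2 (Finset.mem_filter.1 (Finset.mem_filter.1 hi).1).2
  refine hi0.trans_le (h2 ?_)
  exact Finset.card_le_card fun k hk => Finset.mem_filter.2 ⟨Finset.mem_univ _, hmin k hk⟩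

theorem exp_half_le_one_add {x : ℝ} (hx0 : 0 ≤ x) (hx1 : x ≤ 1) : Real.exp (x / 2) ≤ 1 + x := by
  have h1 := Real.add_one_le_exp (-(x / 2))
  rw [Real.exp_neg, ← one_div, le_div_iff₀ (Real.exp_pos _)] at h1
  have h2 := Real.exp_pos (x / 2)
  nlinarith [mul_nonneg hx0 (by linarith : 0 ≤ 1 - x)]

/-- After `16 log(p/α) / (η m)` steps of growth by `1 + η m / 4` the level `p² / α` is passed. -/
theorem sq_div_le_growth {p α η m : ℝ} {T₁ : ℕ} (hα : 0 < α) (hp : 0 < p) (hηm : 0 < η * m)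
    (hηm1 : η * m ≤ 1) (hT₁ : 16 * Real.log (p / α) / (η * m) ≤ T₁) :
    p ^ 2 / α ≤ α * (1 + η * m / 4) ^ T₁ := by
  -- Each step gains at least `exp(η m / 8)`, so `16 log(p/α) / (η m)` steps gain `(p/α)²`.
  have h1 : Real.exp (2 * Real.log (p / α)) ≤ (1 + η * m / 4) ^ T₁ := by
    calc Real.exp (2 * Real.log (p / α)) ≤ Real.exp (T₁ * (η * m / 4 / 2)) := by
          rw [div_le_iff₀ hηm] at hT₁
          refine Real.exp_le_exp.2 ?_
          linarith
      _ = Real.exp (η * m / 4 / 2) ^ T₁ := Real.exp_nat_mul _ _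
      _ ≤ _ := by
          gcongr
          exact exp_half_le_one_add (by linarith) (by linarith)
  have h2 : Real.exp (2 * Real.log (p / α)) = (p / α) ^ 2 := by
    rw [mul_comm, Real.exp_mul, Real.exp_log (by positivity)]
    norm_cast
  rw [h2] at h1
  calc p ^ 2 / α = α * (p / α) ^ 2 := by field_simp
    _ ≤ _ := by gcongr

/-! ### Deterministic recovery on the good noise event. -/

set_option maxHeartbeats 1000000 in
/-- The conclusion on the estimator, on the event that the noise correlates little with the
columns of the design. -/
theorem gdEstimator_close {C : ℝ} (hC : 0 < C) {n p : ℕ} (hp : 2 ≤ p)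
    {X : Matrix (Fin n) (Fin p) ℝ} {βstar : Fin p → ℝ} {σ δ α η : ℝ} (hσ : 0 ≤ σ)
    (hne : (strongSignals n σ βstar).Nonempty)
    (hunion : vecSupport βstar = strongSignals n σ βstar ∪ weakSignals n σ βstar)
    (hκC : condNumber n σ βstar * minStrength n σ βstar ≤ C)
    (hX : RIP X ((vecSupport βstar).card + 1) δ)
    (hδ : δ ≤ 1 / 1000 / (condNumber n σ βstar * Real.sqrt ((vecSupport βstar).card : ℝ)
      * Real.log (p / α)))
    (hα : 0 < α) (hα' : α ≤ 1 / (2 * (1 + C)) / p) (hη : 0 < η)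
    (hη' : η ≤ 1 / (1000 * (1 + C)) / (condNumber n σ βstar * Real.log (p / α)))
    {t : ℕ} (ht : 16 * Real.log (p / α) / (η * minStrength n σ βstar) ≤ (t : ℝ))
    (ht' : (t : ℝ) * (η * tauLevel n p σ δ α) ≤ 1 / 10000)
    (hwin : 1 / (p : ℝ) ≤ σ * Real.sqrt (Real.log p / n)) {w : Fin n → ℝ}
    (hw : ∀ j, |1 / (n : ℝ) * (Xᵀ *ᵥ w) j| ≤ 4 * σ * Real.sqrt (Real.log p / n)) :
    tauLevel n p σ δ α ≤ minStrength n σ βstar / 1000 ∧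
    (∀ j ∈ strongSignals n σ βstar,
      |gdEstimator X (X *ᵥ βstar + w) α η t j - βstar j| ≤ |βstar j| / 2) ∧
    ∀ j, j ∉ strongSignals n σ βstar →
      |gdEstimator X (X *ᵥ βstar + w) α η t j| ≤ 2 * α ^ 2 := by
  classical
  set S := vecSupport βstar with hS
  set S₁ := strongSignals n σ βstar with hS₁
  set m := minStrength n σ βstar with hm
  set κ := condNumber n σ βstar with hκ
  set L := Real.log (p / α) with hL
  set τ := tauLevel n p σ δ α with hτ
  set τ' := σ * Real.sqrt (Real.log p / n) with hτ'
  set K := ⨆ i, |βstar i| with hK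
  obtain ⟨j₀, hj₀⟩ := hne
  have hm0 : 0 < m := minStrength_pos ⟨j₀, hj₀⟩
  have hmle : ∀ j ∈ S₁, m ≤ |βstar j| := fun j hj => minStrength_le hj
  have hleK : ∀ j, |βstar j| ≤ K := fun j =>
    le_ciSup (f := fun i => |βstar i|) (Set.finite_range _).bddAbove j
  have hmK : m ≤ K := (hmle j₀ hj₀).trans (hleK j₀)
  have hκm : κ * m = K := div_mul_cancel₀ _ hm0.ne'
  have hκ1 : 1 ≤ κ := (one_le_div hm0).2 hmK
  have hKC : K ≤ C := hκm ▸ hκC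
  have hS₁S : S₁ ⊆ S := Finset.filter_subset _ _
  have hcard : 1 ≤ S.card := Finset.card_pos.2 ⟨j₀, hS₁S hj₀⟩
  have hp2 : (2 : ℝ) ≤ p := by exact_mod_cast hp
  have hδ0 : 0 ≤ δ := hX.nonneg (by omega) j₀
  -- the initialization level and the logarithm
  have hαp : α * p ≤ 1 / (2 * (1 + C)) := by rwa [le_div_iff₀ (by linarith)] at hα'
  have hαp' : α * p * (2 * (1 + C)) ≤ 1 := by rwa [le_div_iff₀ (by linarith)] at hαp
  have hαC : α * (1 + C) ≤ 1 / 4 := by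
    have : α * (1 + C) * 4 ≤ α * (1 + C) * (2 * p) := by gcongr; linarith
    linarith
  have hα4 : α ≤ 1 / 4 := le_trans (le_mul_of_one_le_right hα.le (by linarith)) hαC
  have hαp2 : α * p ≤ 1 / 2 := by
    have : α * p * 2 ≤ α * p * (2 * (1 + C)) := by gcongr; linarith
    linarith
  have hL1 : 1 ≤ L := by
    rw [hL, Real.le_log_iff_exp_le (by positivity)]
    refine Real.exp_one_lt_d9.le.trans ?_
    rw [le_div_iff₀ hα]
    linarith
  have hs1 : 1 ≤ Real.sqrt (S.card : ℝ) := Real.one_le_sqrt.2 (by exact_mod_cast hcard)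
  -- the incoherence level
  set ε := δ * Real.sqrt (S.card : ℝ) with hε
  have hε0 : 0 ≤ ε := by positivity
  have hεκL : ε * κ * L ≤ 1 / 1000 := by
    rw [le_div_iff₀ (by positivity)] at hδ
    linarith
  have hεκ : ε * κ ≤ 1 / 1000 := le_trans (le_mul_of_one_le_right (by positivity) hL1) hεκL
  have hε1 : ε ≤ 1 / 1000 := le_trans (le_mul_of_one_le_right hε0 hκ1) hεκ
  have hεK : ε * K ≤ m / 1000 := by
    rw [← hκm, ← mul_assoc]
    have := mul_le_mul_of_nonneg_right hεκ hm0.le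
    linarith
  -- the step size
  have hηκL : η * (κ * L) ≤ 1 / (1000 * (1 + C)) := by
    rwa [le_div_iff₀ (by positivity)] at hη'
  have hηκ : η * κ ≤ 1 / (1000 * (1 + C)) := by
    refine le_trans ?_ hηκL
    rw [← mul_assoc]
    exact le_mul_of_one_le_right (by positivity) hL1
  have hηκ' : η * κ * (1000 * (1 + C)) ≤ 1 := by rwa [le_div_iff₀ (by linarith)] at hηκ
  have hηK : η * K ≤ 1 / 1000 := by
    have : η * κ * m ≤ η * κ * (1 + C) := by gcongr; linarith
    rw [← hκm, ← mul_assoc]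
    linarith
  have hη1 : η ≤ 1 / 1000 := by
    have h1 : η ≤ η * κ := le_mul_of_one_le_right hη.le hκ1
    have h2 : η * κ ≤ η * κ * (1 + C) := le_mul_of_one_le_right (by positivity) (by linarith)
    linarith
  have hηm0 : 0 < η * m := by positivity
  have hηm1 : η * m ≤ 1 / 1000 := (mul_le_mul_of_nonneg_left hmK hη.le).trans hηK
  -- the stopping window
  have hτ'0 : 0 ≤ τ' := by positivity
  have hτ'τ : τ' ≤ τ := le_max_right _ _
  have hδατ : δ * α ≤ τ := le_max_left _ _
  have hτ0 : 0 ≤ τ := hτ'0.trans hτ'τ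
  -- Since `t` lies between both ends of the stopping window, `16 L / (η m) ≤ 1 / (10000 η τ)` when
  -- `τ > 0`; this separates signal from noise.
  have hτm : τ ≤ m / 1000 := by
    have h1 : 16 * L ≤ t * (η * m) := by rwa [div_le_iff₀ hηm0] at ht
    have h2 : 16 * L * τ ≤ t * (η * m) * τ := mul_le_mul_of_nonneg_right h1 hτ0
    have h3 : t * (η * m) * τ = t * (η * τ) * m := by ring
    have h4 : t * (η * τ) * m ≤ 1 / 10000 * m := mul_le_mul_of_nonneg_right ht' hm0.le
    have h5 : 1 * τ ≤ L * τ := mul_le_mul_of_nonneg_right hL1 hτ0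
    linarith
  -- Uses that the threshold interval is nonempty: `α ≤ 1 / p ≤ τ' ≤ m / 1000`.
  have hαm : α ^ 2 ≤ m := by
    have h1 : α ≤ 1 / p := by
      rw [le_div_iff₀ (by linarith)]
      linarith
    have h2 : α ^ 2 ≤ α := pow_le_of_le_one hα.le (by linarith) two_ne_zero
    linarith
  -- At most `τ` from the null coordinates, `2τ` and a little more from the weak signals and `4τ`
  -- from the noise; `9` leaves room.
  set T := 9 * τ with hT
  have hT0 : 0 ≤ T := by positivity
  set T₁ := ⌈16 * L / (η * m)⌉₊ with hT₁
  have hT₁t : T₁ ≤ t := Nat.ceil_le.2 ht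
  have hT₁le : (T₁ : ℝ) ≤ 16 * L / (η * m) + 1 := (Nat.ceil_lt_add_one (by positivity)).le
  have hgrow : 2 * K + α ^ 2 < (α * (1 + η * m / 4) ^ T₁) ^ 2 := by
    have h1 := sq_div_le_growth hα (by linarith : (0 : ℝ) < p) hηm0 (by linarith)
      (Nat.le_ceil (16 * L / (η * m)))
    have h2 : 8 * (1 + C) ≤ (p : ℝ) ^ 2 / α := by
      rw [le_div_iff₀ hα]
      have : (2 : ℝ) ^ 2 ≤ (p : ℝ) ^ 2 := by gcongr
      linarith
    have h3 : (8 * (1 + C)) ^ 2 ≤ (α * (1 + η * m / 4) ^ T₁) ^ 2 :=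
      pow_le_pow_left₀ (by positivity) (h2.trans h1) 2
    have h4 : α ^ 2 ≤ 1 := pow_le_one₀ hα.le (by linarith)
    have h5 : (8 * (1 + C)) ^ 2 = 64 + 128 * C + 64 * C ^ 2 := by ring
    have h6 := sq_nonneg C
    linarith
  have hsum : η * ∑ u ∈ Finset.range t, (ε * errEnvelope K T η m T₁ u + T) ≤ 1 := by
    have h1 := sum_errEnvelope_le (hm0.le.trans hmK) hT0 hηm0 (by linarith) T₁ t
    rw [Finset.sum_add_distrib, ← Finset.mul_sum, Finset.sum_const, Finset.card_range, nsmul_eq_mul]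
    have h2 : ε * ∑ u ∈ Finset.range t, errEnvelope K T η m T₁ u ≤
        ε * ((16 * L / (η * m) + 1) * K + 2 * K / (η * m) + t * (4 * T)) := by
      refine mul_le_mul_of_nonneg_left (h1.trans ?_) hε0
      have : 0 ≤ K := hm0.le.trans hmK
      gcongr
    -- In order: growth phase, rounding up of `T₁`, geometric phase, floor of the envelope, and `T`
    -- itself. The first term is why `δ` must beat `log(p/α)`.
    have h3 : η * (ε * ((16 * L / (η * m) + 1) * K + 2 * K / (η * m) + t * (4 * T)) + t * T) =
        16 * (ε * κ * L) + ε * (η * K) + 2 * (ε * κ) + 36 * ε * (t * (η * τ)) +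
          9 * (t * (η * τ)) := by
      rw [← hκm, hT]
      field_simp
      ring
    have h4 : ε * (η * K) ≤ 1 / 1000 * (1 / 1000) := by
      have : 0 ≤ η * K := mul_nonneg hη.le (hm0.le.trans hmK)
      gcongr
    have h5 : 36 * ε * (t * (η * τ)) ≤ 36 * (1 / 1000) * (1 / 10000) := by gcongr
    calc _ ≤ η * (ε * ((16 * L / (η * m) + 1) * K + 2 * K / (η * m) + t * (4 * T)) + t * T) := by
          gcongr
      _ ≤ 1 := by rw [h3]; linarith
  -- the dynamics
  set y := X *ᵥ βstar + w with hy
  set θ : Fin p → ℝ := fun j => if j ∈ S₁ then βstar j else 0 with hθ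
  set ω : Fin p → ℝ := fun j => if j ∈ S₁ then 0 else βstar j with hω
  have hθω : θ + ω = βstar := by
    funext j
    by_cases hj : j ∈ S₁ <;> simp [hθ, hω, hj]
  have hωW : ∀ j, |ω j| ≤ 2 * τ' := by
    intro j
    by_cases hj : j ∈ S₁
    · simpa [hω, hj] using hτ'0
    · simp only [hω, hj, if_false]
      by_cases hj' : βstar j = 0
      · simpa [hj'] using hτ'0
      · have hjS : j ∈ S₁ ∪ weakSignals n σ βstar :=
          hunion ▸ Finset.mem_filter.2 ⟨Finset.mem_univ _, hj'⟩
        have h1 := (Finset.mem_filter.1 ((Finset.mem_union.1 hjS).resolve_left hj)).2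
        rw [hτ']
        linarith
  set g : ℕ → Fin p → ℝ := fun u => (gdIterate X y α η u).1 with hg
  set l : ℕ → Fin p → ℝ := fun u => (gdIterate X y α η u).2 with hl
  have hgl : ∀ u j, ((g u j + l u j) ^ 2 - (g u j - l u j) ^ 2) / 4 = g u j * l u j := by
    intro u j; ring
  obtain ⟨c1, c2⟩ := signal_recovery_of_dynamics (S₁ := S₁) (θ := θ)
    (a := fun u j => g u j + l u j) (b := fun u j => g u j - l u j)
    (e := fun u j => residualGrad X y (g u) (l u) j - (g u j * l u j - θ j))
    (α := α) (η := η) (m := m) (K := K) (T := T) (ε := ε) (T₁ := T₁) (t := t)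
    (fun j => by simp [hg, hl, gdIterate]) (fun j => by simp [hg, hl, gdIterate])
    (fun u j => by
      simp only [hgl]
      simp only [hg, hl, gdIterate, Pi.sub_apply, Pi.smul_apply, Pi.mul_apply, smul_eq_mul]
      ring)
    (fun u j => by
      simp only [hgl]
      simp only [hg, hl, gdIterate, Pi.sub_apply, Pi.smul_apply, Pi.mul_apply, smul_eq_mul]
      ring)
    (fun j hj => by simp [hθ, hj]) (fun j hj => by simpa [hθ, hj] using hmle j hj)
    (fun j => by
      by_cases hj : j ∈ S₁
      · simpa [hθ, hj] using hleK j
      · simpa [hθ, hj] using hm0.le.trans hmK)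
    (by
      intro u D hD0 hD hM j
      simp only [hgl] at hD hM
      have h1 := hX.residual_sub_le (S₁ := S₁) (θ := θ) (ω := ω) (v := g u * l u) (y := y)
        (w := w) (D := D) (M := 2 * α ^ 2) (W := 2 * τ') (A := 4 * τ') hS₁S hcard hδ0
        (by rw [hθω]) (fun i hi => by simp [hθ, hi])
        (fun i hi => by
          have h2 : i ∉ S₁ := fun h => hi (hS₁S h)
          have h3 : βstar i = 0 := by
            by_contra hc
            exact hi (Finset.mem_filter.2 ⟨Finset.mem_univ _, hc⟩)
          simp [hω, h2, h3])
        hωW hD0 (by positivity) hD hM j (by rw [hτ', ← mul_assoc]; exact hw j)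
      refine (le_of_eq ?_).trans (h1.trans ?_)
      · simp [residualGrad]
      · have k1 : δ * (p * (2 * α ^ 2)) ≤ τ := by
          have : δ * (p * (2 * α ^ 2)) = δ * α * (2 * (α * p)) := by ring
          rw [this]
          have : δ * α * (2 * (α * p)) ≤ δ * α * 1 := by gcongr; linarith
          linarith
        have k2 : δ * (Real.sqrt S.card * (2 * τ')) ≤ 1 / 1000 * (2 * τ') := by
          rw [← mul_assoc]; gcongr
        have k3 : δ * (Real.sqrt S.card * D) = ε * D := by rw [hε]; ring
        linarith)
    hα (by linarith) hαm hm0 hmK hη (by linarith) hηK hT0 (by linarith) hε0 hε1 (by linarith)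
    hgrow hT₁t hsum
  simp only [hgl] at c1 c2
  refine ⟨hτm, fun j hj => ?_, fun j hj => c2 j hj⟩
  have := c1 j hj
  simp only [hθ, hj, if_true] at this
  exact this

/-! ### Thresholding and the main theorem. -/

theorem mem_vecSupport {p : ℕ} {u : Fin p → ℝ} {j : Fin p} : j ∈ vecSupport u ↔ u j ≠ 0 := by
  simp [vecSupport]

theorem mem_vecSupport_hardThreshold {p : ℕ} {lam : ℝ} (hlam : 0 < lam) {u : Fin p → ℝ}
    {j : Fin p} : j ∈ vecSupport (hardThreshold lam u) ↔ lam ≤ |u j| := by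
  rw [mem_vecSupport, hardThreshold]
  split_ifs with h
  · simpa [h] using abs_pos.1 (hlam.trans_le h)
  · simpa using h

theorem mainTheorem3 :
    ∀ C : ℝ, 0 < C →
    ∃ cδ cα cη c₁ c₂ c₃ c₄ c₁₀ c₁₁ : ℝ,
      0 < cδ ∧ 0 < cα ∧ 0 < cη ∧ 0 < c₁ ∧ 0 < c₂ ∧ 0 < c₃ ∧ 0 < c₄ ∧ 0 < c₁₀ ∧ 0 < c₁₁ ∧
      ∀ (n p : ℕ), 1 ≤ n → 1 ≤ p →
      ∀ (X : Matrix (Fin n) (Fin p) ℝ) (βstar : Fin p → ℝ) (σ δ α η : ℝ),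
        0 ≤ σ →
        (strongSignals n σ βstar).Nonempty →
        -- Assumption (A)
        vecSupport βstar = strongSignals n σ βstar ∪ weakSignals n σ βstar →
        (vecSupport βstar).card = (strongSignals n σ βstar).card + (weakSignals n σ βstar).card →
        condNumber n σ βstar * minStrength n σ βstar ≤ C →
        -- Assumption (B)
        RIP X ((vecSupport βstar).card + 1) δ →
        δ ≤ cδ / (condNumber n σ βstar * Real.sqrt ((vecSupport βstar).card : ℝ)
              * Real.log (p / α)) →
        -- Assumption (C)
        0 < α → α ≤ cα / p →
        0 < η → η ≤ cη / (condNumber n σ βstar * Real.log (p / α)) →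
      ∀ (Ω : Type*) [MeasurableSpace Ω] (P : Measure Ω) [IsProbabilityMeasure P]
        (w : Ω → Fin n → ℝ), HasLaw w (gaussianNoise n σ) P →
      -- the early-stopping window `c₁ log(p/α)/(η m) ≤ t ≤ c₂/(η τ)` (no upper limit if `τ = 0`)
      ∀ t : ℕ,
        c₁ * Real.log (p / α) / (η * minStrength n σ βstar) ≤ (t : ℝ) →
        (t : ℝ) * (η * tauLevel n p σ δ α) ≤ c₂ →
        1 - (p : ℝ) ^ (-c₃) - (n : ℝ) ^ (-c₄) ≤
          P.real {ω | ∀ lam : ℝ, c₁₀ / p ≤ lam →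
            lam ≤ c₁₁ * σ * Real.sqrt (Real.log p / n) →
            vecSupport (hardThreshold lam (gdEstimator X (X *ᵥ βstar + w ω) α η t)) =
              strongSignals n σ βstar} := by
  intro C hC
  refine ⟨1 / 1000, 1 / (2 * (1 + C)), 1 / (1000 * (1 + C)), 16, 1 / 10000, 1, 1, 1, 1,
    by norm_num, by positivity, by positivity, by norm_num, by norm_num, by norm_num,
    by norm_num, by norm_num, by norm_num, ?_⟩
  intro n p hn hp X βstar σ δ α η hσ hne hunion _ hκC hX hδ hα hα' hη hη' Ω _ P _ w hw t ht ht'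
  have hn' : 0 ≤ (n : ℝ) ^ (-1 : ℝ) := by positivity
  -- For `p = 1` the claimed probability is at most `0`.
  rcases hp.eq_or_lt with rfl | hp2
  · refine le_trans ?_ measureReal_nonneg
    simpa using hn'
  -- If the interval of thresholds is empty, the event is the whole space; otherwise `σ > 0` and `1
  -- / p ≤ τ`.
  by_cases hwin : 1 / (p : ℝ) ≤ σ * Real.sqrt (Real.log p / n)
  swap
  · have huniv : {ω | ∀ lam : ℝ, 1 / (p : ℝ) ≤ lam →
        lam ≤ 1 * σ * Real.sqrt (Real.log p / n) →
        vecSupport (hardThreshold lam (gdEstimator X (X *ᵥ βstar + w ω) α η t)) =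
          strongSignals n σ βstar} = Set.univ := by
      refine Set.eq_univ_of_forall fun ω lam h1 h2 => absurd (h1.trans h2) ?_
      rwa [one_mul]
    rw [huniv, probReal_univ]
    have : 0 ≤ (p : ℝ) ^ (-1 : ℝ) := by positivity
    linarith
  have hpR : (2 : ℝ) ≤ p := by exact_mod_cast hp2
  have hσ0 : 0 < σ := by
    refine hσ.lt_of_ne fun h => ?_
    rw [← h, zero_mul] at hwin
    have : 0 < 1 / (p : ℝ) := by positivity
    linarith
  have hδ1 : δ ≤ 1 := by
    obtain ⟨j₀, hj₀⟩ := hne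
    have hm0 : 0 < minStrength n σ βstar := minStrength_pos ⟨j₀, hj₀⟩
    have hκ1 : 1 ≤ condNumber n σ βstar := (one_le_div hm0).2 ((minStrength_le hj₀).trans
      (le_ciSup (f := fun i => |βstar i|) (Set.finite_range _).bddAbove j₀))
    have hs1 : 1 ≤ Real.sqrt ((vecSupport βstar).card : ℝ) :=
      Real.one_le_sqrt.2 (by
        exact_mod_cast Finset.card_pos.2 ⟨j₀, (Finset.filter_subset _ _) hj₀⟩)
    have hα1 : α * p ≤ 1 / 2 := by
      rw [le_div_iff₀ (by linarith)] at hα'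
      refine hα'.trans ?_
      gcongr
      linarith
    have hL1 : 1 ≤ Real.log (p / α) := by
      rw [Real.le_log_iff_exp_le (by positivity)]
      refine Real.exp_one_lt_d9.le.trans ?_
      rw [le_div_iff₀ hα]
      nlinarith
    refine hδ.trans ((div_le_one (by positivity)).2 ?_)
    calc (1 / 1000 : ℝ) ≤ 1 * 1 * 1 := by norm_num
      _ ≤ _ := by gcongr
  set G : Set (Fin n → ℝ) := {w | ∀ j, |1 / (n : ℝ) * (Xᵀ *ᵥ w) j| ≤
    4 * σ * Real.sqrt (Real.log p / n)} with hG
  have hGm : MeasurableSet G := by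
    rw [hG, Set.ofPred_forall]
    refine MeasurableSet.iInter fun j => measurableSet_le ?_ measurable_const
    simp only [Matrix.mulVec, dotProduct]
    fun_prop
  have hGc := gaussianNoise_transpose_mulVec_le hn hp2 hσ0 (X := X) fun j =>
    (hX.column_le (by omega) j).trans (by linarith)
  have hpre : P.real (w ⁻¹' G) = (gaussianNoise n σ).real G := by
    rw [← hw.map_eq, map_measureReal_apply_of_aemeasurable hw.aemeasurable hGm]
  calc 1 - (p : ℝ) ^ (-1 : ℝ) - (n : ℝ) ^ (-1 : ℝ) ≤ 1 - (gaussianNoise n σ).real Gᶜ := by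
        linarith
    _ = P.real (w ⁻¹' G) := by rw [hpre, probReal_compl_eq_one_sub hGm]; ring
    _ ≤ _ := by
      refine measureReal_mono fun ω hω lam h1 h2 => ?_
      obtain ⟨k1, k2, k3⟩ := gdEstimator_close hC hp2 hσ hne hunion hκC hX hδ hα hα' hη hη' ht ht'
        hwin hω
      have hlam : 0 < lam := lt_of_lt_of_le (by positivity) h1
      have hlamτ : lam ≤ tauLevel n p σ δ α := by
        rw [one_mul] at h2
        exact h2.trans (le_max_right _ _)
      have hαp : α * p ≤ 1 / 2 := by
        rw [le_div_iff₀ (by linarith)] at hα'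
        refine hα'.trans ?_
        gcongr
        linarith
      have hαlam : 2 * α ^ 2 < lam := by
        refine lt_of_lt_of_le ?_ h1
        rw [lt_div_iff₀ (by linarith)]
        nlinarith
      ext j
      rw [mem_vecSupport_hardThreshold hlam]
      constructor
      · intro h
        by_contra hj
        linarith [k3 j hj]
      · intro hj
        have hmj := minStrength_le hj
        have hm0 := minStrength_pos hne
        have h3 := k2 j hj
        -- A strong entry of the estimator has size at least `|β_j| / 2 ≥ m / 2 ≥ 500 τ ≥ λ`.
        have h4 := abs_sub_abs_le_abs_sub (βstar j)
          (gdEstimator X (X *ᵥ βstar + w ω) α η t j)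
        rw [abs_sub_comm] at h4
        linarith
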